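/- Let $d\ge 1$ and $n\ge 2$. Let $F(\mathbb R^d,n)\subset\mathbb R^{d\times n}$ be the set of real matrices $x=(x_1,\dots,x_n)$ with pairwise distinct columns $x_k\in\mathbb R^d$, and let $W_n^{\oplus d}=\{x\in\mathbb R^{d\times n}: x_1+\dots+x_n=0\}$. The symmetric group $\mathfrak S_n$ acts on $\mathbb R^{d\times n}$ by permuting columns, $(\pi\cdot x)_{\pi(k)}=x_k$. Let $\mathcal P(d,n)$ be the set of strings $(\sigma,\mathbf i)=(\sigma_1<_{i_1}\sigma_2<_{i_2}\cdots<_{i_{n-1}}\sigma_n)$ with $\sigma=\sigma_1\cdots\sigma_n\in\mathfrak S_n$ a permutation and $\mathbf i=(i_1,\dots,i_{n-1})\in\{1,\dots,d\}^{n-1}$. Put $(\sigma,\mathbf i)\preceq(\sigma',\mathbf i')$ if and only if (**) whenever $\dots a\dots<_{i'_q}\dots b\dots$ appear in this order in $(\sigma',\mathbf i')$, then either $\dots a\dots<_{i_p}\dots b\dots$ appear in this order in $(\sigma,\mathbf i)$ for some $p$ with $i_p\le i'_q$, or $\dots b\dots<_{i_p}\dots a\dots$ appear in this order in $(\sigma,\mathbf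 i)$ for some $p$ with $i_p<i'_q$. This is a partial order, and $\mathfrak S_n$ acts on the poset $\mathcal P(d,n)$ by $\pi\cdot(\sigma,\mathbf i)=(\pi\sigma,\mathbf i)$. For $(\sigma,\mathbf i)\in\mathcal P(d,n)$ set $\tilde x_{\sigma_1}:=0$ and $\tilde x_{\sigma_{j+1}}:=\tilde x_{\sigma_j}+e_{i_j}$ for $1\le j<n$, where $e_i$ is the $i$th standard unit vector of $\mathbb R^d$, and let $v(\sigma,\mathbf i)=(x_1,\dots,x_n)$, $x_j:=\tilde x_j-\frac1n(\tilde x_1+\dots+\tilde x_n)$, be the image of $\tilde x$ under the orthogonal projection $\mathbb R^{d\times n}\to W_n^{\oplus d}$. Then the following hold. 1. The points $v(\sigma,\mathbf i)$ are pairwise distinct, $\pi\cdot v(\sigma,\mathbf i)=v(\pi\sigma,\mathbf i)$ for all $\pi\in\mathfrak S_n$, and the simplices spanned by the sets $\{v(c):c\in T\}$, for the nonempty chains $T$ of $\mathcal P(d,n)$, form a geometric simplicial complex in $W_n^{\oplus d}$, which is thus a geometric realization of the order complex $\Delta\mathcal P(d,n)$. Its underlying space $|\Delta\mathcal P(d,n)|\subset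 W_n^{\oplus d}$ is compact, is contained in $F(\mathbb R^d,n)$, and is an $\mathfrak S_n$-equivariant strong deformation retract of $F(\mathbb R^d,n)$. 2. This space carries the structure of a finite regular CW complex $\mathcal F(d,n)$ of dimension $(d-1)(n-1)$, with $n!$ vertices, $n!$ facets (which are exactly the cells of dimension $(d-1)(n-1)$), and, if $d\ge2$, $(n-1)\,n!$ ridges (cells of dimension $(d-1)(n-1)-1$). Its nonempty cells $\check c(\sigma,\mathbf i)$ are indexed by $\mathcal P(d,n)$; the cell $\check c(\sigma,\mathbf i)$ has dimension $(i_1+\dots+i_{n-1})-(n-1)$; and the closed cell $\check c(\sigma,\mathbf i)$ is contained in the closed cell $\check c(\sigma',\mathbf i')$ if and only if $(\sigma,\mathbf i)\preceq(\sigma',\mathbf i')$. 3. The simplicial complex in part 1 is the barycentric subdivision of $\mathcal F(d,n)$: the point $v(\sigma,\mathbf i)$ lies in the open cell $\check c(\sigma,\mathbf i)$, and the closed cell $\check c(\sigma,\mathbf i)$ is the union of the simplices whose vertices are $v(c)$ for $c$ in a chain of elements $c\preceq(\sigma,\mathbf i)$. The group $\mathfrak S_n$ permutes the closed cells by $\pi\cdot\check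 c(\sigma,\mathbf i)=\check c(\pi\sigma,\mathbf i)$. -/

import Mathlib

noncomputable section

/-! ### Configurations of labelled points -/

/-- The Euclidean space `ℝ^{d × n}` of real `d × n` matrices `x = (x_1, …, x_n)`, given by its
columns `x k ∈ ℝ^d`, with the standard inner product. -/
abbrev Config (d n : ℕ) : Type :=
  PiLp 2 (fun _ : Fin n => EuclideanSpace ℝ (Fin d))

/-- The symmetric group permutes columns: the column of `π • x` with label `π k` is the column of
`x` with label `k`. -/
instance Config.instMulAction (d n : ℕ) : MulAction (Equiv.Perm (Fin n)) (Config d n) where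
  smul π x := WithLp.toLp 2 (fun k => x (π⁻¹ k))
  one_smul _ := rfl
  mul_smul _ _ _ := rfl

/-- The configuration space `F(ℝ^d, n)`: the columns are pairwise distinct. -/
def confSpace (d n : ℕ) : Set (Config d n) :=
  {x | ∀ j k : Fin n, j ≠ k → x j ≠ x k}

/-- The subspace `W_n^{⊕d}` of `ℝ^{d × n}`: the columns sum to zero. -/
def sumZero (d n : ℕ) : Submodule ℝ (Config d n) where
  carrier := {x | ∑ k, x k = 0}
  add_mem' {x y} hx hy := by
    simp only [Set.mem_ofPred_eq] at hx hy ⊢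
    simp [Finset.sum_add_distrib, hx, hy]
  zero_mem' := by simp
  smul_mem' c x hx := by
    simp only [Set.mem_ofPred_eq] at hx ⊢
    simp [← Finset.smul_sum, hx]

/-- Translation of the barycenter to the origin: `x_j ↦ x_j - (1/n) (x_1 + ⋯ + x_n)`. -/
def recenter {d n : ℕ} (x : Config d n) : Config d n :=
  WithLp.toLp 2 (fun j => x j - (1 / (n : ℝ)) • ∑ k, x k)

/-! ### The index poset -/

/-- The strings `(σ_1 <_{i_1} σ_2 <_{i_2} ⋯ <_{i_{n-1}} σ_n)`, where `σ` is a permutation and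
`(i_1, …, i_{n-1}) ∈ {1, …, d}^{n-1}`. Labels, positions and coordinates are counted from `0`, so
`idx j : Fin d` stands for the coordinate `i = idx j + 1` and sits between the positions
`j` and `j + 1`. -/
@[ext]
structure CellIndex (d n : ℕ) where
  /-- `perm s` is the label in position `s`. -/
  perm : Equiv.Perm (Fin n)
  /-- The index vector, counted from `0`. -/
  idx : Fin (n - 1) → Fin d

namespace CellIndex

variable {d n : ℕ}

/-- The entry `i_j ∈ {1, …, d}` of the index vector. -/
def index (c : CellIndex d n) (j : Fin (n - 1)) : ℕ := (c.idx j : ℕ) + 1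

/-- `… a … <_{i_p} … b …` appear in this order in the string `c`: the label `a` stands in position
`p` or before, and the label `b` stands in position `p + 1` or after. -/
def Appear (c : CellIndex d n) (a : Fin n) (p : Fin (n - 1)) (b : Fin n) : Prop :=
  (c.perm.symm a : ℕ) ≤ (p : ℕ) ∧ (p : ℕ) < (c.perm.symm b : ℕ)

/-- The face relation: whenever `… a … <_{i'_q} … b …` appear in this order in `c'`, then either
`… a … <_{i_p} … b …` appear in this order in `c` with `i_p ≤ i'_q`, or
`… b … <_{i_p} … a …` appear in this order in `c` with `i_p < i'_q`. -/
def FaceLE (c c' : CellIndex d n) : Prop :=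
  ∀ (a b : Fin n) (q : Fin (n - 1)), c'.Appear a q b →
    (∃ p, c.Appear a p b ∧ c.index p ≤ c'.index q) ∨
    (∃ p, c.Appear b p a ∧ c.index p < c'.index q)

theorem FaceLE.refl (c : CellIndex d n) : FaceLE c c :=
  fun _ _ q h => Or.inl ⟨q, h, le_rfl⟩

theorem FaceLE.trans {c c' c'' : CellIndex d n} (h : FaceLE c c') (h' : FaceLE c' c'') :
    FaceLE c c'' := by
  intro a b r hr
  rcases h' a b r hr with ⟨q, hq, hqr⟩ | ⟨q, hq, hqr⟩
  · rcases h a b q hq with ⟨p, hp, hpq⟩ | ⟨p, hp, hpq⟩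
    · exact Or.inl ⟨p, hp, hpq.trans hqr⟩
    · exact Or.inr ⟨p, hp, hpq.trans_le hqr⟩
  · rcases h b a q hq with ⟨p, hp, hpq⟩ | ⟨p, hp, hpq⟩
    · exact Or.inr ⟨p, hp, hpq.trans_lt hqr⟩
    · exact Or.inl ⟨p, hp, (hpq.trans hqr).le⟩

theorem FaceLE.appear {c c' : CellIndex d n} (h : FaceLE c c') (h' : FaceLE c' c) :
    ∀ (m : ℕ) (a b : Fin n) (q : Fin (n - 1)), c'.index q = m → c'.Appear a q b →
      ∃ p, c.Appear a p b ∧ c.index p ≤ m := by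
  intro m
  induction m using Nat.strong_induction_on with
  | _ m ih =>
    intro a b q hm hq
    rcases h a b q hq with ⟨p, hp, hpq⟩ | ⟨p, hp, hpq⟩
    · exact ⟨p, hp, hm ▸ hpq⟩
    · rcases h' b a p hp with ⟨r, hr, _⟩ | ⟨r, hr, hrp⟩
      · simp only [Appear] at hr hq; omega
      · obtain ⟨s, hs, hsr⟩ := ih (c'.index r) (by omega) a b r rfl hr
        exact ⟨s, hs, by omega⟩

theorem FaceLE.antisymm {c c' : CellIndex d n} (h : FaceLE c c') (h' : FaceLE c' c) :
    c = c' := by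
  have hmono : StrictMono (fun s => c.perm.symm (c'.perm s)) := by
    intro s t hst
    have hst' : (s : ℕ) < t := hst
    have ht := t.isLt
    obtain ⟨p, hp, _⟩ := h.appear h' _ (c'.perm s) (c'.perm t) ⟨s, by omega⟩ rfl
      (by simp [Appear, hst'])
    simp only [Appear] at hp
    exact Fin.lt_def.2 (show (c.perm.symm (c'.perm s) : ℕ) < c.perm.symm (c'.perm t) by omega)
  have hid : ∀ s, c.perm.symm (c'.perm s) = s := by
    let f : Fin n ≃o Fin n :=
      StrictMono.orderIsoOfSurjective _ hmono (c'.perm.trans c.perm.symm).surjective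
    intro s
    have hf : f = OrderIso.refl (Fin n) := Subsingleton.elim _ _
    exact congrArg (fun g : Fin n ≃o Fin n => g s) hf
  have hperm : c.perm = c'.perm := by
    ext s
    rw [← hid s, Equiv.apply_symm_apply, hid s]
  have key : ∀ {e e' : CellIndex d n}, FaceLE e e' → FaceLE e' e → e.perm = e'.perm →
      ∀ j, e.index j ≤ e'.index j := by
    intro e e' g g' hee j
    have hj := j.isLt
    obtain ⟨p, hp, hpj⟩ := g.appear g' _ (e'.perm ⟨j, by omega⟩) (e'.perm ⟨j + 1, by omega⟩) j rfl
      (by simp [Appear])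
    simp only [Appear, hee, Equiv.symm_apply_apply] at hp
    have : p = j := Fin.ext (by omega)
    exact this ▸ hpj
  refine CellIndex.ext hperm (funext fun j => Fin.ext ?_)
  have h1 := key h h' hperm j
  have h2 := key h' h hperm.symm j
  simp only [index] at h1 h2
  omega

/-- The poset of strings with the face relation. -/
instance : PartialOrder (CellIndex d n) where
  le := FaceLE
  le_refl := FaceLE.refl
  le_trans _ _ _ := FaceLE.trans
  le_antisymm _ _ := FaceLE.antisymm

/-- The action `π · (σ, i) = (π σ, i)`. -/
instance : MulAction (Equiv.Perm (Fin n)) (CellIndex d n) where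
  smul π c := ⟨π * c.perm, c.idx⟩
  one_smul _ := rfl
  mul_smul _ _ _ := rfl

/-- The points `x̃`: `x̃_{σ(1)} = 0` and `x̃_{σ(j+1)} = x̃_{σ(j)} + e_{i_j}`, that is,
the point with label `a` is the sum of the `e_{i_p}` over all `p` before the position of `a`. -/
def preVertex (c : CellIndex d n) : Config d n :=
  WithLp.toLp 2 (fun a => ∑ p : Fin (n - 1),
    if (p : ℕ) < (c.perm.symm a : ℕ) then EuclideanSpace.single (c.idx p) (1 : ℝ) else 0)

theorem preVertex_first (c : CellIndex d n) (hn : 0 < n) : c.preVertex (c.perm ⟨0, hn⟩) = 0 := by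
  simp [preVertex]

theorem preVertex_succ (c : CellIndex d n) (j : Fin (n - 1)) :
    c.preVertex (c.perm ⟨j + 1, by omega⟩) =
      c.preVertex (c.perm ⟨j, by omega⟩) + EuclideanSpace.single (c.idx j) (1 : ℝ) := by
  have h : EuclideanSpace.single (c.idx j) (1 : ℝ) =
      ∑ p : Fin (n - 1), if p = j then EuclideanSpace.single (c.idx p) (1 : ℝ) else 0 := by simp
  simp only [preVertex, Equiv.symm_apply_apply]
  rw [h, ← Finset.sum_add_distrib]
  refine Finset.sum_congr rfl fun p _ => ?_
  by_cases h1 : p = j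
  · subst h1; simp
  · have h2 : (p : ℕ) ≠ j := fun h => h1 (Fin.ext h)
    have h3 : (p : ℕ) < j + 1 ↔ (p : ℕ) < j := by omega
    simp [h1, h3]

/-- The vertex `v(σ, i)`. -/
def vertex (c : CellIndex d n) : Config d n := recenter c.preVertex

end CellIndex

/-! ### Topological notions -/

/-- `A` is a `G`-equivariant strong deformation retract of `X` (both subsets of a space `E` with
an action of `G`): both are `G`-invariant, `A ⊆ X`, and there is a homotopy `X × [0,1] → X` from
the identity to a map with values in `A`, which fixes every point of `A` at all times and which
commutes with the action of `G` at all times. -/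
def IsEquivariantStrongDeformationRetract (G : Type*) [Group G] {E : Type*} [TopologicalSpace E]
    [MulAction G E] (A X : Set E) : Prop :=
  A ⊆ X ∧ (∀ (g : G), ∀ x ∈ X, g • x ∈ X) ∧ (∀ (g : G), ∀ x ∈ A, g • x ∈ A) ∧
  ∃ (r : C(X, X)) (H : (ContinuousMap.id X).HomotopyRel r {x : X | (x : E) ∈ A}),
    (∀ x : X, (r x : E) ∈ A) ∧
    ∀ (g : G) (t : unitInterval) (x y : X), (y : E) = g • (x : E) →
      (H (t, y) : E) = g • (H (t, x) : E)

/-- A CW complex is regular if every characteristic map is injective on the whole closed ball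
(hence a homeomorphism onto the closed cell): no identifications on the boundary. -/
def IsRegularCW {X : Type*} [TopologicalSpace X] (C : Set X) [Topology.CWComplex C] : Prop :=
  ∀ (m : ℕ) (i : Topology.CWComplex.cell C m),
    Set.InjOn (Topology.CWComplex.map (C := C) m i) (Metric.closedBall 0 1)

end

/-! Sort the points of a configuration lexicographically and record, for neighbours, the first
coordinate in which they differ: this cuts `confSpace d n` into relatively open polyhedral cones,
one per string. Larger strings have smaller cones: `c' ≤ c` exactly when `c.cone` lies in
`c'.ccone`. The order complex is dual to this stratification, and `c.vertex` is a point of its cone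
at which every defining gap equals 1.

Everything rests on one fact about such stratifications (`ConeStratification`): each vector is
uniquely a nonnegative combination of selected points along a chain, plus a residual in the
remainder that lies in the closed cones of that chain. For existence, subtract the selected point of
the current stratum until a wall is hit; this leads to a strictly larger stratum or to the
remainder. For uniqueness, the least element of the chain is the stratum of the vector, so it can be
peeled off. The coefficients are homogeneous with closed graph, and compactness makes them
continuous.

The fact is used twice. With the colliding configurations as remainder (`freeStratification`),
points of the order complex have residual 0, so their barycentric coordinates are unique
(`comb_injOn`), and normalizing the coefficients retracts the configuration space equivariantly. A
configuration and its image share a convex cone, so the straight segment between them avoids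
collisions (`segment_mem_confSpace`).

With the strata below a fixed `c`, seen infinitesimally at `c.vertex`, and `c.lin` as remainder
(`sliceStratification`), the coefficients depend only on the class modulo `c.lin`. A complement of
`c.lin`, of dimension `c.dim`, thereby becomes the open cone over the order complex of the proper
faces of `c` (`exists_radial_coords`). Giving the remaining weight `1 - ‖y‖` to `c` itself turns the
unit ball into the closed cell and the sphere into its boundary (`exists_charMap`), injectively;
this is the regular CW structure. -/

noncomputable section

open Topology Filter Set

/-! ### Chain decompositions in cone stratifications -/

/-- A finite family of relatively open polyhedral cones `lin s ∩ {func s j > 0, j ∈ act s}`, indexed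
by a poset, which together with a closed cone `rem` cover a vector space, such that the order of the
index poset is the reversed face order, with a selected point in each cone. -/
structure ConeStratification (S ι E : Type*) [PartialOrder S] [NormedAddCommGroup E]
    [NormedSpace ℝ E] where
  lin : S → Submodule ℝ E
  func : S → ι → E →ₗ[ℝ] ℝ
  act : S → Finset ι
  act_nonempty : ∀ s, (act s).Nonempty
  pt : S → E
  pt_mem : ∀ s, pt s ∈ lin s
  func_pt : ∀ s, ∀ j ∈ act s, func s j (pt s) = 1
  rem : Set E
  isClosed_rem : IsClosed rem
  zero_mem_rem : (0 : E) ∈ rem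
  smul_mem_rem : ∀ t : ℝ, 0 < t → ∀ x ∈ rem, t • x ∈ rem
  le_of_mem : ∀ s s' x, x ∈ lin s → (∀ j ∈ act s, 0 ≤ func s j x) → x ∈ lin s' →
    (∀ j ∈ act s', 0 < func s' j x) → s ≤ s'
  closed_anti : ∀ s s' x, s ≤ s' → x ∈ lin s' → (∀ j ∈ act s', 0 ≤ func s' j x) →
    x ∈ lin s ∧ ∀ j ∈ act s, 0 ≤ func s j x
  cover : ∀ x, x ∈ rem ∨ ∃ s, x ∈ lin s ∧ ∀ j ∈ act s, 0 < func s j x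
  notMem_rem : ∀ s x, x ∈ lin s → (∀ j ∈ act s, 0 < func s j x) → x ∉ rem

namespace ConeStratification

variable {S ι E : Type*} [PartialOrder S] [NormedAddCommGroup E] [NormedSpace ℝ E]
  (A : ConeStratification S ι E)

/-- The relatively open cone of a stratum. -/
def openCone (s : S) : Set E := {x | x ∈ A.lin s ∧ ∀ j ∈ A.act s, 0 < A.func s j x}

/-- The closure of the cone of a stratum. -/
def closedCone (s : S) : Set E := {x | x ∈ A.lin s ∧ ∀ j ∈ A.act s, 0 ≤ A.func s j x}

variable {A}

theorem openCone_subset_closedCone (s : S) : A.openCone s ⊆ A.closedCone s :=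
  fun _ hx => ⟨hx.1, fun j hj => (hx.2 j hj).le⟩

theorem add_mem_openCone {s : S} {x y : E} (hx : x ∈ A.openCone s) (hy : y ∈ A.closedCone s) :
    x + y ∈ A.openCone s :=
  ⟨add_mem hx.1 hy.1, fun j hj => by
    rw [map_add]; exact add_pos_of_pos_of_nonneg (hx.2 j hj) (hy.2 j hj)⟩

theorem add_mem_closedCone {s : S} {x y : E} (hx : x ∈ A.closedCone s)
    (hy : y ∈ A.closedCone s) : x + y ∈ A.closedCone s :=
  ⟨add_mem hx.1 hy.1, fun j hj => by rw [map_add]; exact add_nonneg (hx.2 j hj) (hy.2 j hj)⟩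

theorem zero_mem_closedCone (s : S) : (0 : E) ∈ A.closedCone s :=
  ⟨zero_mem _, fun j _ => by simp⟩

theorem smul_mem_closedCone {s : S} {x : E} {t : ℝ} (ht : 0 ≤ t) (hx : x ∈ A.closedCone s) :
    t • x ∈ A.closedCone s :=
  ⟨Submodule.smul_mem _ _ hx.1, fun j hj => by
    rw [map_smul]; exact mul_nonneg ht (hx.2 j hj)⟩

theorem smul_mem_openCone {s : S} {x : E} {t : ℝ} (ht : 0 < t) (hx : x ∈ A.openCone s) :
    t • x ∈ A.openCone s :=
  ⟨Submodule.smul_mem _ _ hx.1, fun j hj => by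
    rw [map_smul]; exact mul_pos ht (hx.2 j hj)⟩

theorem pt_mem_openCone (s : S) : A.pt s ∈ A.openCone s :=
  ⟨A.pt_mem s, fun j hj => by rw [A.func_pt s j hj]; exact one_pos⟩

theorem closedCone_anti {s s' : S} (h : s ≤ s') : A.closedCone s' ⊆ A.closedCone s :=
  fun x hx => A.closed_anti s s' x h hx.1 hx.2

theorem le_of_mem_cones {s s' : S} {x : E} (h : x ∈ A.closedCone s) (h' : x ∈ A.openCone s') :
    s ≤ s' := A.le_of_mem s s' x h.1 h.2 h'.1 h'.2

theorem eq_of_mem_openCones {s s' : S} {x : E} (h : x ∈ A.openCone s) (h' : x ∈ A.openCone s') :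
    s = s' :=
  le_antisymm (le_of_mem_cones (openCone_subset_closedCone s h) h')
    (le_of_mem_cones (openCone_subset_closedCone s' h') h)

theorem isClosed_closedCone [FiniteDimensional ℝ E] (s : S) : IsClosed (A.closedCone s) := by
  have : A.closedCone s = (A.lin s : Set E) ∩ ⋂ j ∈ A.act s, {x | 0 ≤ A.func s j x} := by
    ext x; simp [closedCone]
  rw [this]
  refine (Submodule.closed_of_finiteDimensional _).inter (isClosed_biInter fun j _ => ?_)
  exact isClosed_le continuous_const (LinearMap.continuous_of_finiteDimensional _)

/-- All functionals equal 1 at the selected point, so they decrease at the same rate along it; the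
least of their values at `y` is the exit time. -/
theorem exists_sub_mem_frontier {s : S} {y : E} (hy : y ∈ A.openCone s) :
    ∃ t : ℝ, 0 < t ∧ y - t • A.pt s ∈ A.closedCone s ∧ y - t • A.pt s ∉ A.openCone s := by
  obtain ⟨j, hj, hmin⟩ := Finset.exists_min_image (A.act s) (fun j => A.func s j y)
    (A.act_nonempty s)
  refine ⟨A.func s j y, hy.2 j hj, ⟨?_, fun k hk => ?_⟩, fun h => ?_⟩
  · exact sub_mem hy.1 (Submodule.smul_mem _ _ (A.pt_mem s))
  · rw [map_sub, map_smul, A.func_pt s k hk, smul_eq_mul, mul_one, sub_nonneg]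
    exact hmin k hk
  · have := h.2 j hj
    rw [map_sub, map_smul, A.func_pt s j hj, smul_eq_mul, mul_one, sub_self] at this
    exact lt_irrefl _ this

variable [Fintype S]

variable (A) in
/-- The linear combination of the selected points with coefficients `l`. -/
def comb (l : S → ℝ) : E := ∑ s, l s • A.pt s

theorem comb_add (l m : S → ℝ) : A.comb (l + m) = A.comb l + A.comb m := by
  simp [comb, add_smul, Finset.sum_add_distrib]

theorem comb_smul (t : ℝ) (l : S → ℝ) : A.comb (t • l) = t • A.comb l := by
  simp [comb, mul_smul, Finset.smul_sum]

theorem comb_zero : A.comb 0 = 0 := by simp [comb]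

theorem comb_single [DecidableEq S] (s : S) (t : ℝ) : A.comb (Pi.single s t) = t • A.pt s := by
  simp [comb, Pi.single_apply]

theorem continuous_comb : Continuous A.comb := by
  unfold comb; fun_prop

variable (A) in
/-- The coefficients `l` of a decomposition of `x` along a chain of strata. -/
structure IsDecomp (x : E) (l : S → ℝ) : Prop where
  nonneg : ∀ s, 0 ≤ l s
  chain : ∀ s s', l s = 0 ∨ l s' = 0 ∨ s ≤ s' ∨ s' ≤ s
  rem_mem : x - A.comb l ∈ A.rem
  mem_closedCone : ∀ s, l s = 0 ∨ x - A.comb l ∈ A.closedCone s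

/-- The term at `s` is strictly inside the cone, and the selected points of larger strata lie in its
closure, so adding them does not leave the open cone. -/
theorem add_comb_mem_openCone {l : S → ℝ} {r : E} {s : S} (h0 : ∀ s', 0 ≤ l s') (hs : l s ≠ 0)
    (hle : ∀ s', l s' ≠ 0 → s ≤ s') (hr : r ∈ A.closedCone s) : A.comb l + r ∈ A.openCone s := by
  classical
  unfold comb
  rw [← Finset.add_sum_erase _ _ (Finset.mem_univ s), add_assoc]
  refine add_mem_openCone (smul_mem_openCone (lt_of_le_of_ne (h0 s) hs.symm) (pt_mem_openCone s))
    (add_mem_closedCone ?_ hr)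
  refine Finset.sum_induction _ (· ∈ A.closedCone s) (fun _ _ => add_mem_closedCone)
    (zero_mem_closedCone s) fun s' _ => ?_
  by_cases h : l s' = 0
  · rw [h, zero_smul]; exact zero_mem_closedCone s
  · exact smul_mem_closedCone (h0 s')
      (closedCone_anti (hle s' h) (openCone_subset_closedCone _ (pt_mem_openCone s')))

/-- The least element of the chain is the stratum containing `x`, hence does not depend on the
decomposition; uniqueness hinges on this. -/
theorem IsDecomp.exists_least {x : E} {l : S → ℝ} (h : A.IsDecomp x l) (hl : l ≠ 0) :
    ∃ s, l s ≠ 0 ∧ (∀ s', l s' ≠ 0 → s ≤ s') ∧ x ∈ A.openCone s := by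
  obtain ⟨s0, hs0⟩ : ∃ s, l s ≠ 0 := by
    by_contra! hc
    exact hl (funext hc)
  obtain ⟨s, hs, hmin⟩ := Set.Finite.exists_minimal (Set.toFinite {s | l s ≠ 0}) ⟨s0, hs0⟩
  have hle : ∀ s', l s' ≠ 0 → s ≤ s' := by
    intro s' hs'
    rcases h.chain s s' with h1 | h1 | h1 | h1
    · exact absurd h1 hs
    · exact absurd h1 hs'
    · exact h1
    · exact hmin hs' h1
  refine ⟨s, hs, hle, ?_⟩
  have := add_comb_mem_openCone (A := A) h.nonneg hs hle ((h.mem_closedCone s).resolve_left hs)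
  rwa [add_sub_cancel] at this

theorem IsDecomp.eq_zero_of_mem_rem {x : E} {l : S → ℝ} (h : A.IsDecomp x l) (hx : x ∈ A.rem) :
    l = 0 := by
  by_contra hl
  obtain ⟨s, -, -, hs⟩ := h.exists_least hl
  exact A.notMem_rem s x hs.1 hs.2 hx

/-- Induction from larger strata to smaller ones: leaving the cone of `s` along its selected point
ends in the remainder or in a strictly larger stratum, whose decomposition is extended by `s`. -/
theorem exists_isDecomp_of_mem_openCone (s : S) : ∀ y ∈ A.openCone s,
    ∃ l, A.IsDecomp y l ∧ ∀ s', l s' ≠ 0 → s ≤ s' := by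
  classical
  induction s using WellFoundedGT.induction with
  | _ s ih =>
    intro y hy
    obtain ⟨t, ht, hz, hz'⟩ := exists_sub_mem_frontier hy
    rcases A.cover (y - t • A.pt s) with hR | ⟨s', hs'⟩
    · refine ⟨Pi.single s t, ⟨?_, ?_, ?_, ?_⟩, ?_⟩
      · intro s'; by_cases h : s' = s
        · subst h; simpa using ht.le
        · simp [h]
      · intro a b
        by_cases h : a = s
        · by_cases h' : b = s
          · right; right; left; rw [h, h']
          · right; left; simp [h']
        · left; simp [h]
      · rwa [comb_single]
      · intro a
        by_cases h : a = s
        · right; rw [comb_single, h]; exact hz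
        · left; simp [h]
      · intro a ha
        by_cases h : a = s
        · rw [h]
        · simp [h] at ha
    · have hle := le_of_mem_cones hz hs'
      have hlt : s < s' := lt_of_le_of_ne hle (fun h => hz' (h ▸ hs'))
      obtain ⟨l, hl, hsup⟩ := ih s' hlt _ hs'
      have hcomb : y - A.comb (l + (Pi.single s t : S → ℝ)) = y - t • A.pt s - A.comb l := by
        rw [comb_add, comb_single]; abel
      have hle' : ∀ a, (l + (Pi.single s t : S → ℝ)) a ≠ 0 → s ≤ a := by
        intro a ha
        by_cases h : a = s
        · rw [h]
        · have : l a ≠ 0 := by simpa [h] using ha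
          exact hle.trans (hsup a this)
      refine ⟨l + Pi.single s t, ⟨?_, ?_, ?_, ?_⟩, hle'⟩
      · intro a
        refine add_nonneg (hl.nonneg a) ?_
        by_cases h : a = s
        · subst h; simpa using ht.le
        · simp [h]
      · intro a b
        by_cases hb0 : (l + (Pi.single s t : S → ℝ)) b = 0
        · exact Or.inr (Or.inl hb0)
        by_cases ha0 : (l + (Pi.single s t : S → ℝ)) a = 0
        · exact Or.inl ha0
        by_cases h : a = s
        · right; right; left; rw [h]; exact hle' b hb0
        by_cases h' : b = s
        · right; right; right; rw [h']; exact hle' a ha0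
        simpa [h, h'] using hl.chain a b
      · rw [hcomb]; exact hl.rem_mem
      · intro a
        rw [hcomb]
        by_cases h : a = s
        · right
          rw [h]
          -- The residual must lie in the closed cone of `s` too: either it is the exit point
          -- itself, or it lies in the closed cone of some larger stratum of the chain.
          by_cases hl0 : l = 0
          · rw [hl0, comb_zero, sub_zero]; exact hz
          · obtain ⟨b, hb⟩ : ∃ b, l b ≠ 0 := by
              by_contra! hc
              exact hl0 (funext hc)
            exact closedCone_anti (hle.trans (hsup b hb)) ((hl.mem_closedCone b).resolve_left hb)
        · simpa [h] using hl.mem_closedCone a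

theorem isDecomp_zero {x : E} (hx : x ∈ A.rem) : A.IsDecomp x 0 :=
  ⟨fun _ => le_rfl, fun _ _ => Or.inl rfl, by rwa [comb_zero, sub_zero], fun _ => Or.inl rfl⟩

theorem exists_isDecomp (x : E) : ∃ l, A.IsDecomp x l := by
  rcases A.cover x with h | ⟨s, hs⟩
  · exact ⟨0, isDecomp_zero h⟩
  · obtain ⟨l, hl, -⟩ := exists_isDecomp_of_mem_openCone s x hs
    exact ⟨l, hl⟩

theorem IsDecomp.sub_single [DecidableEq S] {x : E} {l : S → ℝ} (h : A.IsDecomp x l) {s : S}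
    {t : ℝ} (ht0 : 0 ≤ t) (ht : t ≤ l s) :
    A.IsDecomp (x - t • A.pt s) (l - Pi.single s t) := by
  have h0 : ∀ a, l a = 0 → (l - (Pi.single s t : S → ℝ)) a = 0 := by
    intro a ha
    by_cases hs : a = s
    · subst hs; simp; linarith
    · simp [hs, ha]
  have hcomb : x - t • A.pt s - A.comb (l - Pi.single s t) = x - A.comb l := by
    have : A.comb l = A.comb (l - Pi.single s t) + t • A.pt s := by
      rw [← comb_single, ← comb_add, sub_add_cancel]
    rw [this]; abel
  refine ⟨fun a => ?_, fun a b => ?_, ?_, fun a => ?_⟩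
  · by_cases hs : a = s
    · subst hs; simpa using ht
    · simpa [hs] using h.nonneg a
  · rcases h.chain a b with h1 | h1 | h1
    · exact Or.inl (h0 a h1)
    · exact Or.inr (Or.inl (h0 b h1))
    · exact Or.inr (Or.inr h1)
  · rw [hcomb]; exact h.rem_mem
  · rw [hcomb]; exact (h.mem_closedCone a).imp_left (h0 a)

/-- Both decompositions start at the stratum of `x`. Subtracting the smaller of the two coefficients
there leaves decompositions of a common vector with fewer nonzero terms in total. -/
theorem IsDecomp.unique {x : E} {l m : S → ℝ} (hl : A.IsDecomp x l) (hm : A.IsDecomp x m) :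
    l = m := by
  classical
  obtain ⟨N, hN⟩ : ∃ N, (Finset.univ.filter (l · ≠ 0)).card +
    (Finset.univ.filter (m · ≠ 0)).card = N := ⟨_, rfl⟩
  induction N using Nat.strong_induction_on generalizing x l m with
  | _ N ih =>
    by_cases hx : x ∈ A.rem
    · rw [hl.eq_zero_of_mem_rem hx, hm.eq_zero_of_mem_rem hx]
    have hl0 : l ≠ 0 := by
      rintro rfl
      exact hx (by simpa [comb_zero] using hl.rem_mem)
    have hm0 : m ≠ 0 := by
      rintro rfl
      exact hx (by simpa [comb_zero] using hm.rem_mem)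
    obtain ⟨s, hs, -, hxs⟩ := hl.exists_least hl0
    obtain ⟨s', hs', -, hxs'⟩ := hm.exists_least hm0
    obtain rfl := eq_of_mem_openCones hxs hxs'
    have key : ∀ {l m : S → ℝ}, A.IsDecomp x l → A.IsDecomp x m → l s ≠ 0 → l s ≤ m s →
        (Finset.univ.filter (l · ≠ 0)).card + (Finset.univ.filter (m · ≠ 0)).card = N →
        l = m := by
      intro l m hl hm hs hlm hN
      have h1 := hl.sub_single (hl.nonneg s) le_rfl
      have h2 := hm.sub_single (hl.nonneg s) hlm
      have hc1 : (Finset.univ.filter ((l - (Pi.single s (l s) : S → ℝ)) · ≠ 0)).card <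
          (Finset.univ.filter (l · ≠ 0)).card := by
        apply Finset.card_lt_card
        rw [Finset.ssubset_iff_of_subset]
        · exact ⟨s, by simpa using hs, by simp⟩
        · intro a
          by_cases h : a = s
          · subst h; simp
          · simp [h]
      have hc2 : (Finset.univ.filter ((m - (Pi.single s (l s) : S → ℝ)) · ≠ 0)).card ≤
          (Finset.univ.filter (m · ≠ 0)).card := by
        apply Finset.card_le_card
        intro a
        by_cases h : a = s
        · subst h
          have : 0 < l a := lt_of_le_of_ne (hl.nonneg a) hs.symm
          have : m a ≠ 0 := by linarith [this] |> fun h : 0 < m a => h.ne'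
          simp [this]
        · simp [h]
      have := ih _ (by omega) h1 h2 rfl
      exact sub_left_injective this
    rcases le_total (l s) (m s) with h | h
    · exact key hl hm hs h hN
    · exact (key hm hl hs' h (by omega)).symm

variable (A) in
/-- The coefficients of the decomposition of a vector along a chain of strata. -/
def coeffs (x : E) : S → ℝ := (exists_isDecomp (A := A) x).choose

theorem isDecomp_coeffs (x : E) : A.IsDecomp x (A.coeffs x) :=
  (exists_isDecomp (A := A) x).choose_spec

theorem IsDecomp.coeffs_eq {x : E} {l : S → ℝ} (h : A.IsDecomp x l) : A.coeffs x = l :=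
  (isDecomp_coeffs x).unique h

theorem IsDecomp.smul {x : E} {l : S → ℝ} (h : A.IsDecomp x l) {t : ℝ} (ht : 0 < t) :
    A.IsDecomp (t • x) (t • l) := by
  have h0 : ∀ a, l a = 0 → (t • l) a = 0 := fun a ha => by simp [ha]
  have hcomb : t • x - A.comb (t • l) = t • (x - A.comb l) := by rw [comb_smul, smul_sub]
  refine ⟨fun a => mul_nonneg ht.le (h.nonneg a), fun a b => ?_, ?_, fun a => ?_⟩
  · rcases h.chain a b with h1 | h1 | h1
    · exact Or.inl (h0 a h1)
    · exact Or.inr (Or.inl (h0 b h1))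
    · exact Or.inr (Or.inr h1)
  · rw [hcomb]; exact A.smul_mem_rem t ht _ h.rem_mem
  · rw [hcomb]; exact (h.mem_closedCone a).imp (h0 a) (smul_mem_closedCone ht.le)

theorem coeffs_smul (x : E) {t : ℝ} (ht : 0 < t) : A.coeffs (t • x) = t • A.coeffs x :=
  ((isDecomp_coeffs x).smul ht).coeffs_eq

theorem coeffs_eq_zero_iff {x : E} : A.coeffs x = 0 ↔ x ∈ A.rem := by
  refine ⟨fun h => ?_, fun h => (isDecomp_zero h).coeffs_eq⟩
  have := (isDecomp_coeffs (A := A) x).rem_mem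
  rwa [h, comb_zero, sub_zero] at this

/-- Every condition is phrased as an alternative with a vanishing coefficient, hence is a finite
union of closed sets and survives when coefficients tend to 0. -/
theorem isClosed_isDecomp [FiniteDimensional ℝ E] :
    IsClosed {p : E × (S → ℝ) | A.IsDecomp p.1 p.2} := by
  have hc : Continuous fun p : E × (S → ℝ) => p.1 - A.comb p.2 :=
    continuous_fst.sub (continuous_comb.comp continuous_snd)
  have hl : ∀ s, Continuous fun p : E × (S → ℝ) => p.2 s := by intro s; fun_prop
  have h0 : ∀ s, IsClosed {p : E × (S → ℝ) | p.2 s = 0} :=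
    fun s => isClosed_eq (hl s) continuous_const
  have : {p : E × (S → ℝ) | A.IsDecomp p.1 p.2} =
      (⋂ s, {p | 0 ≤ p.2 s}) ∩
      (⋂ s, ⋂ s', ({p | p.2 s = 0} ∪ ({p | p.2 s' = 0} ∪ {_p | s ≤ s' ∨ s' ≤ s}))) ∩
      {p | p.1 - A.comb p.2 ∈ A.rem} ∩
      (⋂ s, ({p | p.2 s = 0} ∪ {p | p.1 - A.comb p.2 ∈ A.closedCone s})) := by
    ext p
    simp only [mem_ofPred_eq, mem_inter_iff, mem_iInter, mem_union]
    exact ⟨fun h => ⟨⟨⟨h.1, h.2⟩, h.3⟩, h.4⟩, fun h => ⟨h.1.1.1, h.1.1.2, h.1.2, h.2⟩⟩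
  rw [this]
  refine (((isClosed_iInter fun s => isClosed_le continuous_const (hl s)).inter
    (isClosed_iInter fun s => isClosed_iInter fun s' => (h0 s).union ((h0 s').union
      isClosed_const))).inter (A.isClosed_rem.preimage hc)).inter
    (isClosed_iInter fun s => (h0 s).union ((isClosed_closedCone s).preimage hc))

/-- Coefficients of norm 1 cannot occur at the vector 0, which lies in the remainder. By compactness
they cannot occur near 0 either, and homogeneity turns this into a linear bound. -/
theorem exists_norm_coeffs_le [FiniteDimensional ℝ E] :
    ∃ B : ℝ, ∀ x, ‖A.coeffs x‖ ≤ B * ‖x‖ := by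
  let G : Set (E × (S → ℝ)) :=
    (Metric.closedBall 0 1 ×ˢ Metric.sphere 0 1) ∩ {p | A.IsDecomp p.1 p.2}
  have hG : IsCompact G :=
    ((isCompact_closedBall 0 1).prod (isCompact_sphere 0 1)).inter_right isClosed_isDecomp
  have h0 : (0 : E) ∈ (Prod.fst '' G)ᶜ := by
    rintro ⟨⟨x, l⟩, ⟨h1, h2⟩, rfl⟩
    have hl : l = 0 := h2.eq_zero_of_mem_rem A.zero_mem_rem
    have := h1.2
    rw [hl] at this
    simp at this
  obtain ⟨δ, hδ, hball⟩ := Metric.isOpen_iff.1 (hG.image continuous_fst).isClosed.isOpen_compl 0 h0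
  refine ⟨(min δ 1)⁻¹, fun x => ?_⟩
  have hm : 0 < min δ 1 := lt_min hδ one_pos
  by_cases hl : A.coeffs x = 0
  · rw [hl, norm_zero]; positivity
  have hpos : 0 < ‖A.coeffs x‖ := norm_pos_iff.2 hl
  rw [inv_mul_eq_div, le_div_iff₀ hm]
  by_contra! hlt
  have hd := (isDecomp_coeffs (A := A) x).smul (inv_pos.2 hpos)
  have hx : ‖‖A.coeffs x‖⁻¹ • x‖ < min δ 1 := by
    rw [norm_smul, norm_inv, norm_norm, inv_mul_lt_iff₀ hpos]; exact hlt
  refine hball (a := ‖A.coeffs x‖⁻¹ • x) (by simpa using hx.trans_le (min_le_left _ _))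
    ⟨(_, ‖A.coeffs x‖⁻¹ • A.coeffs x), ⟨⟨?_, ?_⟩, hd⟩, rfl⟩
  · simpa using (hx.trans_le (min_le_right _ _)).le
  · simp [norm_smul, hpos.ne']

/-- The coefficients are locally bounded, and by closedness and uniqueness their only cluster point
at `x` is `A.coeffs x`. -/
theorem continuous_coeffs [FiniteDimensional ℝ E] : Continuous A.coeffs := by
  obtain ⟨B, hB⟩ := exists_norm_coeffs_le (A := A)
  rw [continuous_iff_continuousAt]
  intro x
  refine (isCompact_closedBall (0 : S → ℝ) (|B| * (‖x‖ + 1))).tendsto_nhds_of_unique_mapClusterPt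
    ?_ ?_
  · filter_upwards [Metric.ball_mem_nhds x one_pos] with y hy
    rw [mem_closedBall_zero_iff]
    have h1 : ‖y‖ ≤ ‖x‖ + 1 := by
      have := norm_sub_norm_le y x
      rw [mem_ball_iff_norm] at hy
      linarith
    exact (hB y).trans (mul_le_mul (le_abs_self B) h1 (norm_nonneg _) (abs_nonneg _))
  · intro l _ hl
    obtain ⟨U, hU, hUl⟩ := mapClusterPt_iff_ultrafilter.1 hl
    have hmem : (x, l) ∈ {p : E × (S → ℝ) | A.IsDecomp p.1 p.2} :=
      isClosed_isDecomp.mem_of_tendsto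
        ((tendsto_id'.2 hU).prodMk_nhds hUl)
        (Eventually.of_forall fun y => isDecomp_coeffs y)
    exact hmem.coeffs_eq.symm

end ConeStratification


/-! ### Fox–Neuwirth cones and the face order -/

instance (d n : ℕ) : ContinuousSMul ℝ (Config d n) := IsBoundedSMul.continuousSMul

namespace CellIndex

variable {d n : ℕ}

/-- A string is given by its permutation and its index vector. -/
def prodEquiv (d n : ℕ) : CellIndex d n ≃ Equiv.Perm (Fin n) × (Fin (n - 1) → Fin d) where
  toFun c := (c.perm, c.idx)
  invFun p := ⟨p.1, p.2⟩

instance : Fintype (CellIndex d n) := Fintype.ofEquiv _ (prodEquiv d n).symm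

/-- The label in position `j` of the string. -/
def left (c : CellIndex d n) (j : Fin (n - 1)) : Fin n := c.perm ⟨j, by omega⟩

/-- The label in position `j + 1` of the string. -/
def right (c : CellIndex d n) (j : Fin (n - 1)) : Fin n := c.perm ⟨j + 1, by omega⟩

/-- The linear span of the Fox–Neuwirth cone of `c`. -/
def lin (c : CellIndex d n) : Submodule ℝ (Config d n) where
  carrier := {x | ∀ j, ∀ t < c.idx j, x (c.left j) t = x (c.right j) t}
  add_mem' {x y} hx hy := fun j t ht => by simp [hx j t ht, hy j t ht]
  zero_mem' := by simp
  smul_mem' a x hx := fun j t ht => by simp [hx j t ht]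

/-- The coordinate differences which are positive on the Fox–Neuwirth cone of `c`. -/
def gap (c : CellIndex d n) (j : Fin (n - 1)) : Config d n →ₗ[ℝ] ℝ where
  toFun x := x (c.right j) (c.idx j) - x (c.left j) (c.idx j)
  map_add' x y := by simp; ring
  map_smul' a x := by simp; ring

theorem mem_lin {c : CellIndex d n} {x : Config d n} :
    x ∈ c.lin ↔ ∀ j, ∀ t < c.idx j, x (c.left j) t = x (c.right j) t := Iff.rfl

theorem gap_apply (c : CellIndex d n) (j : Fin (n - 1)) (x : Config d n) :
    c.gap j x = x (c.right j) (c.idx j) - x (c.left j) (c.idx j) := rfl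

/-- The Fox–Neuwirth cone of `c`. -/
def cone (c : CellIndex d n) : Set (Config d n) := {x | x ∈ c.lin ∧ ∀ j, 0 < c.gap j x}

/-- The closed Fox–Neuwirth cone of `c`. -/
def ccone (c : CellIndex d n) : Set (Config d n) := {x | x ∈ c.lin ∧ ∀ j, 0 ≤ c.gap j x}

theorem cone_subset_ccone (c : CellIndex d n) : c.cone ⊆ c.ccone :=
  fun _ hx => ⟨hx.1, fun j => (hx.2 j).le⟩

theorem preVertex_diff (c : CellIndex d n) (j : Fin (n - 1)) (t : Fin d) :
    c.preVertex (c.right j) t - c.preVertex (c.left j) t = if t = c.idx j then 1 else 0 := by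
  rw [right, left, preVertex_succ]
  simp

theorem vertex_diff (c : CellIndex d n) (j : Fin (n - 1)) (t : Fin d) :
    c.vertex (c.right j) t - c.vertex (c.left j) t = if t = c.idx j then 1 else 0 := by
  rw [← preVertex_diff]
  simp [vertex, recenter]

theorem vertex_mem_lin (c : CellIndex d n) : c.vertex ∈ c.lin := by
  intro j t ht
  have := c.vertex_diff j t
  rw [if_neg ht.ne] at this
  linarith

theorem gap_vertex (c : CellIndex d n) (j : Fin (n - 1)) : c.gap j c.vertex = 1 := by
  rw [gap_apply, vertex_diff, if_pos rfl]

theorem vertex_mem_cone (c : CellIndex d n) : c.vertex ∈ c.cone :=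
  ⟨c.vertex_mem_lin, fun j => by rw [gap_vertex]; exact one_pos⟩

/-- At each separator between `a` and `b`, coordinate `t` stays constant if the index exceeds `t`
and weakly increases if it equals `t`. -/
theorem mono_of_index {c : CellIndex d n} {x : Config d n} (hx : x ∈ c.ccone) {a b : Fin n}
    {t : Fin d} (hab : c.perm.symm a ≤ c.perm.symm b)
    (h : ∀ p : Fin (n - 1), c.Appear a p b → t ≤ c.idx p) : x a t ≤ x b t := by
  obtain ⟨s, rfl⟩ := c.perm.surjective a
  obtain ⟨s', rfl⟩ := c.perm.surjective b
  simp only [Equiv.symm_apply_apply, Appear] at hab h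
  obtain ⟨s, hs⟩ := s
  obtain ⟨s', hs'⟩ := s'
  simp only [Fin.mk_le_mk] at hab
  induction s', hab using Nat.le_induction with
  | base => exact le_rfl
  | succ m hm ih =>
    refine (ih (by omega) fun p hp => h p (by simp at hp ⊢; omega)).trans ?_
    have h1 := h ⟨m, by omega⟩ (by simp; omega)
    rcases h1.lt_or_eq with h2 | h2
    · exact (hx.1 ⟨m, by omega⟩ t h2).le
    · have := hx.2 ⟨m, by omega⟩
      rw [gap_apply, ← h2] at this
      exact sub_nonneg.1 this

theorem eq_of_index {c : CellIndex d n} {x : Config d n} (hx : x ∈ c.lin) {a b : Fin n}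
    {t : Fin d} (hab : c.perm.symm a ≤ c.perm.symm b)
    (h : ∀ p : Fin (n - 1), c.Appear a p b → t < c.idx p) : x a t = x b t := by
  obtain ⟨s, rfl⟩ := c.perm.surjective a
  obtain ⟨s', rfl⟩ := c.perm.surjective b
  simp only [Equiv.symm_apply_apply, Appear] at hab h
  obtain ⟨s, hs⟩ := s
  obtain ⟨s', hs'⟩ := s'
  simp only [Fin.mk_le_mk] at hab
  induction s', hab using Nat.le_induction with
  | base => rfl
  | succ m hm ih =>
    refine (ih (by omega) fun p hp => h p (by simp at hp ⊢; omega)).trans ?_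
    exact hx ⟨m, by omega⟩ t (h ⟨m, by omega⟩ (by simp; omega))

/-- The coordinate jumps strictly at the separator `q` and is monotone on both sides, since `q` has
the least index between `a` and `b`. -/
theorem lt_of_index {c : CellIndex d n} {x : Config d n} (hx : x ∈ c.cone) {a b : Fin n}
    {q : Fin (n - 1)} (hq : c.Appear a q b)
    (h : ∀ p : Fin (n - 1), c.Appear a p b → c.idx q ≤ c.idx p) :
    x a (c.idx q) < x b (c.idx q) := by
  have hl : c.perm.symm (c.left q) = ⟨q, by omega⟩ := by simp [left]
  have hr : c.perm.symm (c.right q) = ⟨q + 1, by omega⟩ := by simp [right]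
  simp only [Appear] at hq h
  have h1 : x a (c.idx q) ≤ x (c.left q) (c.idx q) := by
    refine mono_of_index (cone_subset_ccone c hx) ?_ fun p hp => h p ?_
    · rw [hl, Fin.le_def]; exact hq.1
    · simp only [Appear, hl] at hp; omega
  have h2 : x (c.right q) (c.idx q) ≤ x b (c.idx q) := by
    refine mono_of_index (cone_subset_ccone c hx) ?_ fun p hp => h p ?_
    · rw [hr, Fin.le_def]; exact hq.2
    · simp only [Appear, hr] at hp; omega
  have h3 := hx.2 q
  rw [gap_apply] at h3
  linarith

theorem exists_least_index (c : CellIndex d n) {a b : Fin n}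
    (hab : c.perm.symm a < c.perm.symm b) :
    ∃ q, c.Appear a q b ∧ ∀ p, c.Appear a p b → c.idx q ≤ c.idx p := by
  have hlt : (c.perm.symm a : ℕ) < c.perm.symm b := hab
  have hb := (c.perm.symm b).isLt
  obtain ⟨q, hq, hmin⟩ := (Set.toFinite {p | c.Appear a p b}).exists_minimalFor c.idx _
    ⟨⟨c.perm.symm a, by omega⟩, le_rfl, hab⟩
  refine ⟨q, hq, fun p hp => ?_⟩
  rcases le_total (c.idx q) (c.idx p) with h | h
  · exact h
  · exact hmin hp h

theorem index_le_iff {c c' : CellIndex d n} {p q : Fin (n - 1)} :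
    c.index p ≤ c'.index q ↔ c.idx p ≤ c'.idx q := by
  exact Nat.add_le_add_iff_right

theorem index_lt_iff {c c' : CellIndex d n} {p q : Fin (n - 1)} :
    c.index p < c'.index q ↔ c.idx p < c'.idx q := by
  exact Nat.add_lt_add_iff_right

theorem lt_of_appear {c : CellIndex d n} {a b : Fin n} {p : Fin (n - 1)} (h : c.Appear a p b) :
    c.perm.symm a < c.perm.symm b := by
  simp only [Appear] at h
  rw [Fin.lt_def]; omega

/-- In `c`, the least index `k` between `a` and `b` marks a coordinate in which `a` is strictly
below `b`. Too large an index in `c'` would force equality there, or the opposite inequality if `c'`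
lists `b` first. -/
theorem le_of_mem_cone_of_mem_ccone {c c' : CellIndex d n} {x : Config d n} (hx : x ∈ c.cone)
    (hx' : x ∈ c'.ccone) : c' ≤ c := by
  intro a b q hq
  obtain ⟨k, hk, hmin⟩ := c.exists_least_index (lt_of_appear hq)
  have hkq : c.idx k ≤ c.idx q := hmin q hq
  have hlt := lt_of_index hx hk hmin
  have hne : c'.perm.symm a ≠ c'.perm.symm b := by
    intro h
    rw [c'.perm.symm.injective h] at hlt
    exact lt_irrefl _ hlt
  rcases lt_or_gt_of_ne hne with h | h
  · obtain ⟨m, hm, hmmin⟩ := c'.exists_least_index h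
    refine Or.inl ⟨m, hm, index_le_iff.2 ?_⟩
    by_contra! hlt'
    exact hlt.ne (eq_of_index hx'.1 h.le fun p hp => (hkq.trans_lt hlt').trans_le (hmmin p hp))
  · obtain ⟨m, hm, hmmin⟩ := c'.exists_least_index h
    refine Or.inr ⟨m, hm, index_lt_iff.2 ?_⟩
    by_contra! hlt'
    exact hlt.not_ge (mono_of_index hx' h.le fun p hp => hkq.trans (hlt'.trans (hmmin p hp)))

theorem appear_left_right (c : CellIndex d n) {j p : Fin (n - 1)} :
    c.Appear (c.left j) p (c.right j) ↔ p = j := by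
  simp only [Appear, left, right, Equiv.symm_apply_apply, Fin.ext_iff]
  omega

theorem not_appear_right_left (c : CellIndex d n) {j p : Fin (n - 1)} :
    ¬ c.Appear (c.right j) p (c.left j) := by
  simp only [Appear, left, right, Equiv.symm_apply_apply]
  omega

theorem left_ne_right (c : CellIndex d n) (j : Fin (n - 1)) : c.left j ≠ c.right j := by
  intro h
  have := c.perm.injective h
  simp at this

/-- Neighbours in `c'` have a single separator, so the face relation bounds every index that
separates the same two labels in `c`; this controls their coordinate differences on the cone of `c`.
-/
theorem cone_subset_ccone_of_le {c c' : CellIndex d n} (h : c' ≤ c) : c.cone ⊆ c'.ccone := by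
  intro x hx
  have key : ∀ j : Fin (n - 1), (∀ t < c'.idx j, x (c'.left j) t = x (c'.right j) t) ∧
      x (c'.left j) (c'.idx j) ≤ x (c'.right j) (c'.idx j) := by
    intro j
    have hne : c.perm.symm (c'.left j) ≠ c.perm.symm (c'.right j) :=
      fun he => c'.left_ne_right j (c.perm.symm.injective he)
    rcases lt_or_gt_of_ne hne with hlt | hlt
    · have hi : ∀ p, c.Appear (c'.left j) p (c'.right j) → c'.idx j ≤ c.idx p := by
        intro p hp
        rcases h _ _ p hp with ⟨m, hm, hmp⟩ | ⟨m, hm, -⟩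
        · rw [appear_left_right] at hm
          subst hm
          exact index_le_iff.1 hmp
        · exact absurd hm c'.not_appear_right_left
      exact ⟨fun t ht => eq_of_index hx.1 hlt.le fun p hp => ht.trans_le (hi p hp),
        mono_of_index (cone_subset_ccone c hx) hlt.le hi⟩
    · have hi : ∀ p, c.Appear (c'.right j) p (c'.left j) → c'.idx j < c.idx p := by
        intro p hp
        rcases h _ _ p hp with ⟨m, hm, -⟩ | ⟨m, hm, hmp⟩
        · exact absurd hm c'.not_appear_right_left
        · rw [appear_left_right] at hm
          subst hm
          exact index_lt_iff.1 hmp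
      exact ⟨fun t ht => (eq_of_index hx.1 hlt.le fun p hp => ht.trans (hi p hp)).symm,
        (eq_of_index hx.1 hlt.le hi).ge⟩
  exact ⟨fun j => (key j).1, fun j => sub_nonneg.2 (key j).2⟩

theorem add_smul_mem_cone {c : CellIndex d n} {x y : Config d n} (hx : x ∈ c.ccone)
    (hy : y ∈ c.cone) {t : ℝ} (ht : 0 < t) : x + t • y ∈ c.cone :=
  ⟨add_mem hx.1 (Submodule.smul_mem _ _ hy.1), fun j => by
    rw [map_add, map_smul, smul_eq_mul]
    exact add_pos_of_nonneg_of_pos (hx.2 j) (mul_pos ht (hy.2 j))⟩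

/-- All gaps of the vertex are 1, so a large multiple of it moves any vector of `c.lin` into the
cone. Linear statements on the cone thus extend to `c.lin`. -/
theorem exists_add_smul_mem_cone {c : CellIndex d n} {x : Config d n} (hx : x ∈ c.lin) :
    ∃ M : ℝ, 0 < M ∧ x + M • c.vertex ∈ c.cone := by
  have hnn : 0 ≤ ∑ j, |c.gap j x| := Finset.sum_nonneg fun _ _ => abs_nonneg _
  refine ⟨1 + ∑ j, |c.gap j x|, by linarith, add_mem hx (Submodule.smul_mem _ _ c.vertex_mem_lin),
    fun j => ?_⟩
  rw [map_add, map_smul, gap_vertex, smul_eq_mul, mul_one]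
  have := Finset.single_le_sum (f := fun j => |c.gap j x|) (fun _ _ => abs_nonneg _)
    (Finset.mem_univ j)
  have := neg_abs_le (c.gap j x)
  linarith

theorem lin_anti {c c' : CellIndex d n} (h : c' ≤ c) : c.lin ≤ c'.lin := by
  intro x hx
  obtain ⟨M, -, hM⟩ := exists_add_smul_mem_cone hx
  have h1 := (cone_subset_ccone_of_le h hM).1
  have h2 := Submodule.smul_mem c'.lin M (cone_subset_ccone_of_le h c.vertex_mem_cone).1
  simpa using sub_mem h1 h2

theorem ccone_anti {c c' : CellIndex d n} (h : c' ≤ c) : c.ccone ⊆ c'.ccone := by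
  intro x hx
  refine ⟨lin_anti h hx.1, fun j => ?_⟩
  by_contra! hneg
  have hv := (cone_subset_ccone_of_le h c.vertex_mem_cone).2 j
  set g := c'.gap j x
  -- This step length makes the vertex contribute at most `-g / 2`, leaving the gap negative; the `+
  -- 1` keeps the denominator positive when the vertex has gap 0.
  have hpos : 0 < -g / (2 * (c'.gap j c.vertex + 1)) := div_pos (by linarith) (by linarith)
  have := (cone_subset_ccone_of_le h (add_smul_mem_cone hx c.vertex_mem_cone hpos)).2 j
  rw [map_add, map_smul, smul_eq_mul] at this
  have h2 : -g / (2 * (c'.gap j c.vertex + 1)) * c'.gap j c.vertex ≤ -g / 2 := by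
    rw [div_mul_eq_mul_div, div_le_div_iff₀ (by linarith) (by norm_num)]
    nlinarith
  change 0 ≤ g + _ at this
  linarith

theorem cone_eq_of_mem {c c' : CellIndex d n} {x : Config d n} (h : x ∈ c.cone)
    (h' : x ∈ c'.cone) : c = c' :=
  le_antisymm (le_of_mem_cone_of_mem_ccone h' (cone_subset_ccone _ h))
    (le_of_mem_cone_of_mem_ccone h (cone_subset_ccone _ h'))

theorem cone_subset_confSpace (c : CellIndex d n) : c.cone ⊆ confSpace d n := by
  have key : ∀ x ∈ c.cone, ∀ a b, c.perm.symm a < c.perm.symm b → x a ≠ x b := by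
    intro x hx a b hab he
    obtain ⟨k, hk, hmin⟩ := c.exists_least_index hab
    have := lt_of_index hx hk hmin
    rw [he] at this
    exact lt_irrefl _ this
  intro x hx a b hab
  rcases lt_or_gt_of_ne (fun he => hab (c.perm.symm.injective he) :
    c.perm.symm a ≠ c.perm.symm b) with h | h
  · exact key x hx a b h
  · exact (key x hx b a h).symm

/-- Sorting the columns lexicographically gives the permutation; the first coordinate in which
neighbours differ gives the index vector. -/
theorem exists_mem_cone {x : Config d n} (hx : x ∈ confSpace d n) :
    ∃ c : CellIndex d n, x ∈ c.cone := by
  let f : Fin n → Lex (Fin d → ℝ) := fun k => toLex (x k)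
  have hf : Function.Injective f := fun a b hab => by
    by_contra hne
    exact hx a b hne (by ext t; exact congrFun (toLex.injective hab) t)
  have hmono : StrictMono (f ∘ Tuple.sort f) :=
    (Tuple.monotone_sort f).strictMono_of_injective (hf.comp (Tuple.sort f).injective)
  have hlt : ∀ j : Fin (n - 1), ∃ i : Fin d,
      (∀ t < i, x (Tuple.sort f ⟨j, by omega⟩) t = x (Tuple.sort f ⟨j + 1, by omega⟩) t) ∧
      x (Tuple.sort f ⟨j, by omega⟩) i < x (Tuple.sort f ⟨j + 1, by omega⟩) i := by
    intro j
    have := hmono (show (⟨j, by omega⟩ : Fin n) < ⟨j + 1, by omega⟩ by simp)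
    exact this
  choose i hi1 hi2 using hlt
  exact ⟨⟨Tuple.sort f, i⟩, fun j t ht => hi1 j t ht, fun j => sub_pos.2 (hi2 j)⟩

/-! ### The stratification of the configuration space -/

theorem isClosed_ccone (c : CellIndex d n) : IsClosed c.ccone := by
  have : c.ccone = (c.lin : Set (Config d n)) ∩ ⋂ j, {x | 0 ≤ c.gap j x} := by
    ext x; simp [ccone]
  rw [this]
  exact c.lin.closed_of_finiteDimensional.inter (isClosed_iInter fun j =>
    isClosed_le continuous_const (c.gap j).continuous_of_finiteDimensional)

theorem isOpen_confSpace : IsOpen (confSpace d n) := by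
  have : confSpace d n = ⋂ j, ⋂ k, {x | j ≠ k → x j ≠ x k} := by
    ext x; simp [confSpace]
  rw [this]
  refine isOpen_iInter_of_finite fun j => isOpen_iInter_of_finite fun k => ?_
  by_cases h : j = k
  · simp [h]
  · simp only [ne_eq, h, not_false_eq_true, forall_const]
    exact isOpen_ne_fun (by fun_prop) (by fun_prop)

theorem smul_mem_confSpace {x : Config d n} (hx : x ∈ confSpace d n) {t : ℝ} (ht : t ≠ 0) :
    t • x ∈ confSpace d n := by
  intro j k hjk he
  exact hx j k hjk (smul_right_injective _ ht he)

theorem smul_mem_cone {c : CellIndex d n} {x : Config d n} (hx : x ∈ c.cone) {t : ℝ}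
    (ht : 0 < t) : t • x ∈ c.cone :=
  ⟨Submodule.smul_mem _ _ hx.1, fun j => by
    rw [map_smul]; exact mul_pos ht (hx.2 j)⟩

/-- Near the vertex of `c` there are only points in cones of faces of `c`. -/
theorem exists_add_smul_mem_cone_le (c : CellIndex d n) (x : Config d n) :
    ∃ M : ℝ, 0 < M ∧ ∃ c' ≤ c, x + M • c.vertex ∈ c'.cone := by
  classical
  -- An open neighbourhood of the vertex that omits the closed cones of all strings which are not
  -- faces of `c`.
  let U : Set (Config d n) :=
    confSpace d n ∩ ⋂ c' : CellIndex d n, {y | ¬ c' ≤ c → y ∉ c'.ccone}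
  have hU : IsOpen U := by
    refine isOpen_confSpace.inter (isOpen_iInter_of_finite fun c' => ?_)
    by_cases h : c' ≤ c
    · simp [h]
    · simpa only [h, not_false_eq_true, forall_const] using! (isClosed_ccone c').isOpen_compl
  have hv : c.vertex ∈ U := by
    refine ⟨cone_subset_confSpace c c.vertex_mem_cone, mem_iInter.2 fun c' hc' h => hc' ?_⟩
    exact le_of_mem_cone_of_mem_ccone c.vertex_mem_cone h
  -- For small `t > 0` the point `t • x + c.vertex` is in `U`; rescaling by `t⁻¹` gives the witness
  -- `M = t⁻¹`.
  have hcont : Continuous fun t : ℝ => t • x + c.vertex := by fun_prop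
  have hnhds : (fun t : ℝ => t • x + c.vertex) ⁻¹' U ∈ 𝓝 (0 : ℝ) :=
    (hU.preimage hcont).mem_nhds (by simpa using hv)
  obtain ⟨t, htU, ht⟩ := ((mem_nhdsWithin_of_mem_nhds hnhds :
    _ ∈ 𝓝[>] (0 : ℝ)) |> fun h => (Filter.nonempty_of_mem
      (Filter.inter_mem h self_mem_nhdsWithin)))
  have ht' : 0 < t := ht
  obtain ⟨c', hc'⟩ := exists_mem_cone htU.1
  refine ⟨t⁻¹, inv_pos.2 ht', c', ?_, ?_⟩
  · by_contra hle
    exact mem_iInter.1 htU.2 c' hle (cone_subset_ccone _ hc')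
  · have := smul_mem_cone hc' (inv_pos.2 ht')
    rwa [smul_add, inv_smul_smul₀ ht'.ne'] at this

/-- The stratification of the configuration space by the Fox–Neuwirth cones, with the
configurations with coinciding points as remainder. -/
def freeStratification (d n : ℕ) (hn : 2 ≤ n) :
    ConeStratification (CellIndex d n) (Fin (n - 1)) (Config d n) where
  lin := lin
  func := gap
  act _ := Finset.univ
  act_nonempty _ := ⟨⟨0, by omega⟩, Finset.mem_univ _⟩
  pt := vertex
  pt_mem := vertex_mem_lin
  func_pt c j _ := c.gap_vertex j
  rem := (confSpace d n)ᶜ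
  isClosed_rem := isOpen_confSpace.isClosed_compl
  zero_mem_rem h := h ⟨0, by omega⟩ ⟨1, by omega⟩ (by simp) rfl
  smul_mem_rem t ht x hx h := hx (by
    have := smul_mem_confSpace h (inv_ne_zero ht.ne')
    rwa [inv_smul_smul₀ ht.ne'] at this)
  le_of_mem c c' x h1 h2 h3 h4 :=
    le_of_mem_cone_of_mem_ccone ⟨h3, fun j => h4 j (Finset.mem_univ j)⟩
      ⟨h1, fun j => h2 j (Finset.mem_univ j)⟩
  closed_anti c c' x h h1 h2 := by
    have := ccone_anti h ⟨h1, fun j => h2 j (Finset.mem_univ j)⟩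
    exact ⟨this.1, fun j _ => this.2 j⟩
  cover x := by
    by_cases hx : x ∈ confSpace d n
    · obtain ⟨c, hc⟩ := exists_mem_cone hx
      exact Or.inr ⟨c, hc.1, fun j _ => hc.2 j⟩
    · exact Or.inl hx
  notMem_rem c x h1 h2 h :=
    h (cone_subset_confSpace c ⟨h1, fun j => h2 j (Finset.mem_univ j)⟩)

/-! ### The stratification seen from one vertex -/

theorem gap_vertex_nonneg {c c' : CellIndex d n} (h : c' ≤ c) (j : Fin (n - 1)) :
    0 ≤ c'.gap j c.vertex :=
  (cone_subset_ccone_of_le h c.vertex_mem_cone).2 j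

/-- Adding multiples of the vertex does not change this gap, so it is nonnegative on all of `c.lin`;
a linear functional nonnegative on a subspace vanishes there. -/
theorem gap_eq_zero_of_mem_lin {c c' : CellIndex d n} (h : c' ≤ c) {j : Fin (n - 1)}
    (hj : c'.gap j c.vertex = 0) {x : Config d n} (hx : x ∈ c.lin) : c'.gap j x = 0 := by
  have key : ∀ x ∈ c.lin, 0 ≤ c'.gap j x := by
    intro x hx
    obtain ⟨M, -, hM⟩ := exists_add_smul_mem_cone hx
    have := (cone_subset_ccone_of_le h hM).2 j
    rwa [map_add, map_smul, hj, smul_zero, add_zero] at this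
  have h1 := key x hx
  have h2 := key (-x) (neg_mem hx)
  rw [map_neg] at h2
  linarith

open Classical in
/-- The coordinate differences of the stratum `c'` which vanish at the vertex of `c`. -/
def tight (c c' : CellIndex d n) : Finset (Fin (n - 1)) :=
  Finset.univ.filter fun j => c'.gap j c.vertex = 0

theorem mem_tight {c c' : CellIndex d n} {j : Fin (n - 1)} :
    j ∈ c.tight c' ↔ c'.gap j c.vertex = 0 := by simp [tight]

/-- If no gap vanished, `c.vertex` would lie in the open cones of both strings. -/
theorem tight_nonempty {c c' : CellIndex d n} (h : c' < c) : (c.tight c').Nonempty := by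
  by_contra hne
  refine h.ne (cone_eq_of_mem (x := c.vertex) ⟨?_, fun j => ?_⟩ c.vertex_mem_cone)
  · exact lin_anti h.le c.vertex_mem_lin
  · refine lt_of_le_of_ne (gap_vertex_nonneg h.le j) fun he => hne ⟨j, mem_tight.2 he.symm⟩

/-- Far along the vertex direction the gaps that are not tight are automatically positive, so only
the tight ones describe the cones near `c.vertex`. -/
theorem exists_forall_gap_pos {c c' : CellIndex d n} (h : c' ≤ c) (x : Config d n) :
    ∃ M₀ : ℝ, ∀ M ≥ M₀, ∀ j ∉ c.tight c', 0 < c'.gap j (x + M • c.vertex) := by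
  obtain ⟨M₀, hM₀⟩ := Finite.exists_le fun j => (1 - c'.gap j x) / c'.gap j c.vertex
  refine ⟨M₀, fun M hM j hj => ?_⟩
  have hpos : 0 < c'.gap j c.vertex :=
    lt_of_le_of_ne (gap_vertex_nonneg h j) fun he => hj (mem_tight.2 he.symm)
  have := (div_le_iff₀ hpos).1 ((hM₀ j).trans hM)
  rw [map_add, map_smul, smul_eq_mul]
  linarith

theorem exists_add_smul_mem_ccone {c c' : CellIndex d n} (h : c' ≤ c) {x : Config d n}
    (hx : x ∈ c'.lin) (hx' : ∀ j ∈ c.tight c', 0 ≤ c'.gap j x) :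
    ∃ M₀ : ℝ, ∀ M ≥ M₀, x + M • c.vertex ∈ c'.ccone := by
  obtain ⟨M₀, hM₀⟩ := exists_forall_gap_pos h x
  refine ⟨M₀, fun M hM => ⟨add_mem hx (Submodule.smul_mem _ _ (lin_anti h c.vertex_mem_lin)),
    fun j => ?_⟩⟩
  by_cases hj : j ∈ c.tight c'
  · rw [map_add, map_smul, mem_tight.1 hj, smul_zero, add_zero]; exact hx' j hj
  · exact (hM₀ M hM j hj).le

theorem exists_add_smul_mem_cone_of_tight {c c' : CellIndex d n} (h : c' ≤ c) {x : Config d n}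
    (hx : x ∈ c'.lin) (hx' : ∀ j ∈ c.tight c', 0 < c'.gap j x) :
    ∃ M₀ : ℝ, ∀ M ≥ M₀, x + M • c.vertex ∈ c'.cone := by
  obtain ⟨M₀, hM₀⟩ := exists_forall_gap_pos h x
  refine ⟨M₀, fun M hM => ⟨add_mem hx (Submodule.smul_mem _ _ (lin_anti h c.vertex_mem_lin)),
    fun j => ?_⟩⟩
  by_cases hj : j ∈ c.tight c'
  · rw [map_add, map_smul, mem_tight.1 hj, smul_zero, add_zero]; exact hx' j hj
  · exact hM₀ M hM j hj

theorem of_add_smul_mem_ccone {c c' : CellIndex d n} (h : c' ≤ c) {x : Config d n} {M : ℝ}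
    (hx : x + M • c.vertex ∈ c'.ccone) :
    x ∈ c'.lin ∧ ∀ j ∈ c.tight c', 0 ≤ c'.gap j x := by
  refine ⟨?_, fun j hj => ?_⟩
  · simpa using sub_mem hx.1 (Submodule.smul_mem _ M (lin_anti h c.vertex_mem_lin))
  · have := hx.2 j
    rwa [map_add, map_smul, mem_tight.1 hj, smul_zero, add_zero] at this

theorem of_add_smul_mem_cone {c c' : CellIndex d n} (h : c' ≤ c) {x : Config d n} {M : ℝ}
    (hx : x + M • c.vertex ∈ c'.cone) :
    x ∈ c'.lin ∧ ∀ j ∈ c.tight c', 0 < c'.gap j x := by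
  refine ⟨(of_add_smul_mem_ccone h (cone_subset_ccone _ hx)).1, fun j hj => ?_⟩
  have := hx.2 j
  rwa [map_add, map_smul, mem_tight.1 hj, smul_zero, add_zero] at this

/-- The stratification of a neighbourhood of the vertex of `c`, extended to the whole space, with
the linear span of the cone of `c` as remainder. -/
def sliceStratification (c : CellIndex d n) :
    ConeStratification {c' : CellIndex d n // c' < c} (Fin (n - 1)) (Config d n) where
  lin s := s.1.lin
  func s := s.1.gap
  act s := c.tight s.1
  act_nonempty s := tight_nonempty s.2
  pt s := s.1.vertex
  pt_mem s := s.1.vertex_mem_lin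
  func_pt s j _ := s.1.gap_vertex j
  rem := c.lin
  isClosed_rem := c.lin.closed_of_finiteDimensional
  zero_mem_rem := c.lin.zero_mem
  smul_mem_rem t _ x hx := c.lin.smul_mem t hx
  -- Translating by a multiple of `c.vertex` large enough for both strata reduces the claim to the
  -- original cones.
  le_of_mem s s' x h1 h2 h3 h4 := by
    obtain ⟨M₁, hM₁⟩ := exists_add_smul_mem_ccone s.2.le h1 h2
    obtain ⟨M₂, hM₂⟩ := exists_add_smul_mem_cone_of_tight s'.2.le h3 h4
    exact le_of_mem_cone_of_mem_ccone (hM₂ (max M₁ M₂) (le_max_right _ _))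
      (hM₁ (max M₁ M₂) (le_max_left _ _))
  closed_anti s s' x h h1 h2 := by
    obtain ⟨M, hM⟩ := exists_add_smul_mem_ccone s'.2.le h1 h2
    exact of_add_smul_mem_ccone s.2.le (ccone_anti h (hM M le_rfl))
  -- Some translate lies in the cone of a face of `c`; translating back changes neither membership
  -- in its span nor the tight gaps.
  cover x := by
    obtain ⟨M, -, c', hc', hM⟩ := exists_add_smul_mem_cone_le c x
    rcases hc'.lt_or_eq with h | rfl
    · exact Or.inr ⟨⟨c', h⟩, of_add_smul_mem_cone h.le hM⟩
    · exact Or.inl (of_add_smul_mem_cone le_rfl hM).1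
  notMem_rem s x h1 h2 h := by
    obtain ⟨j, hj⟩ := tight_nonempty s.2
    exact (h2 j hj).ne' (gap_eq_zero_of_mem_lin s.2.le (mem_tight.1 hj) h)

/-! ### Codimension of the cones and radial coordinates -/

/-- The dimension of the cell of `c`. -/
def dim (c : CellIndex d n) : ℕ := ∑ j, (c.idx j : ℕ)

/-- The coordinate differences which vanish on the span of the cone of `c`. -/
def normalMap (c : CellIndex d n) : Config d n →ₗ[ℝ] (∀ j, Fin (c.idx j) → ℝ) where
  toFun x j t := x (c.right j) (t.castLE (c.idx j).isLt.le) -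
    x (c.left j) (t.castLE (c.idx j).isLt.le)
  map_add' x y := by ext; simp; ring
  map_smul' a x := by ext; simp; ring

theorem ker_normalMap (c : CellIndex d n) : LinearMap.ker c.normalMap = c.lin := by
  ext x
  rw [LinearMap.mem_ker, mem_lin]
  refine ⟨fun h j t ht => ?_, fun h => ?_⟩
  · have := congrFun (congrFun h j) ⟨t, ht⟩
    exact (sub_eq_zero.1 this).symm
  · ext j t
    exact sub_eq_zero.2 (h j _ t.isLt).symm

/-- Prescribed differences between neighbours are realized by partial sums along the string. Hence
`c.lin` has codimension `c.dim`. -/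
theorem normalMap_surjective (c : CellIndex d n) : Function.Surjective c.normalMap := by
  intro u
  let U : Fin (n - 1) → Fin d → ℝ := fun p t =>
    if h : (t : ℕ) < c.idx p then u p ⟨t, h⟩ else 0
  refine ⟨WithLp.toLp 2 fun a => WithLp.toLp 2 fun t => ∑ p : Fin (n - 1),
    if (p : ℕ) < (c.perm.symm a : ℕ) then U p t else 0, ?_⟩
  ext j t
  have hU : U j (t.castLE (c.idx j).isLt.le) = u j t := dif_pos t.isLt
  simp only [normalMap, LinearMap.coe_mk, AddHom.coe_mk, left, right, Equiv.symm_apply_apply]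
  rw [← hU, ← Finset.sum_sub_distrib, Finset.sum_eq_single j]
  · simp
  · intro p _ hp
    have h2 : (p : ℕ) ≠ j := fun h => hp (Fin.ext h)
    have h3 : (p : ℕ) < j + 1 ↔ (p : ℕ) < j := by omega
    simp [h3]
  · simp

theorem finrank_quotient_lin (c : CellIndex d n) :
    Module.finrank ℝ (Config d n ⧸ c.lin) = c.dim := by
  rw [← ker_normalMap,
    (LinearMap.quotKerEquivOfSurjective _ c.normalMap_surjective).finrank_eq,
    Module.finrank_pi_fintype]
  simp [dim]

/-- The inclusion of spans is strict: `c'.vertex` lies in an open stratum of the slice, which misses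
the remainder `c.lin`. -/
theorem dim_lt_of_lt {c c' : CellIndex d n} (h : c' < c) : c'.dim < c.dim := by
  have hlt : c.lin < c'.lin := by
    refine lt_of_le_of_ne (lin_anti h.le) fun he => ?_
    have hmem : c'.vertex ∈ c.lin := he ▸ c'.vertex_mem_lin
    have := (sliceStratification c).notMem_rem ⟨c', h⟩ c'.vertex c'.vertex_mem_lin
      (fun j _ => by
        change 0 < c'.gap j c'.vertex
        rw [gap_vertex]; exact one_pos)
    exact this hmem
  have h1 := Submodule.finrank_lt_finrank_of_lt hlt
  have h2 := Submodule.finrank_quotient_add_finrank c.lin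
  have h3 := Submodule.finrank_quotient_add_finrank c'.lin
  rw [finrank_quotient_lin] at h2 h3
  omega

theorem exists_normal_section (c : CellIndex d n) {m : ℕ} (hm : c.dim = m) :
    ∃ q : (Fin m → ℝ) →ₗ[ℝ] Config d n, (∀ y, q y ∈ c.lin → y = 0) ∧
      ∀ x, ∃ y, x - q y ∈ c.lin := by
  obtain ⟨Q, hQ⟩ := Submodule.exists_isCompl c.lin
  have hr : Module.finrank ℝ (Fin m → ℝ) = Module.finrank ℝ Q := by
    rw [← (Submodule.quotientEquivOfIsCompl _ _ hQ).finrank_eq, finrank_quotient_lin, hm]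
    simp
  let e : (Fin m → ℝ) ≃ₗ[ℝ] Q := LinearEquiv.ofFinrankEq _ _ hr
  refine ⟨Q.subtype ∘ₗ e.toLinearMap, fun y hy => ?_, fun x => ?_⟩
  · have : (e y : Config d n) = 0 := Submodule.disjoint_def.1 hQ.disjoint _ hy (e y).2
    have h0 : e y = 0 := Subtype.ext this
    exact (LinearEquiv.map_eq_zero_iff e).1 h0
  · have hx : x ∈ c.lin ⊔ Q := by rw [hQ.sup_eq_top]; trivial
    obtain ⟨a, ha, b, hb, rfl⟩ := Submodule.mem_sup.1 hx
    exact ⟨e.symm ⟨b, hb⟩, by simpa using ha⟩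

instance (c : CellIndex d n) : Fintype {c' : CellIndex d n // c' < c} := Fintype.ofFinite _

/-- Polar coordinates around the vertex of `c` in the complex spanned by the vertices of the proper
faces of `c`. -/
theorem exists_radial_coords (c : CellIndex d n) {m : ℕ} (hm : c.dim = m) :
    ∃ μ : (Fin m → ℝ) → ({c' : CellIndex d n // c' < c} → ℝ),
      Continuous μ ∧ Function.Injective μ ∧ (∀ y s, 0 ≤ μ y s) ∧
      (∀ y s s', μ y s = 0 ∨ μ y s' = 0 ∨ s ≤ s' ∨ s' ≤ s) ∧ (∀ y, ∑ s, μ y s = ‖y‖) ∧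
      ∀ l : {c' : CellIndex d n // c' < c} → ℝ, (∀ s, 0 ≤ l s) →
        (∀ s s', l s = 0 ∨ l s' = 0 ∨ s ≤ s' ∨ s' ≤ s) → ∃ y, μ y = l := by
  obtain ⟨q, hq0, hqs⟩ := c.exists_normal_section hm
  let B := c.sliceStratification
  -- Residuals in `c.lin` satisfy the closed cone condition for free, so any nonnegative chain
  -- combination congruent to `x` modulo `c.lin` gives the coefficients of `x`.
  have hlin : ∀ s, ∀ x ∈ c.lin, x ∈ B.closedCone s := fun s x hx =>
    ⟨lin_anti s.2.le hx, fun j hj => (gap_eq_zero_of_mem_lin s.2.le (mem_tight.1 hj) hx).ge⟩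
  have hdec : ∀ (l : {c' : CellIndex d n // c' < c} → ℝ), (∀ s, 0 ≤ l s) →
      (∀ s s', l s = 0 ∨ l s' = 0 ∨ s ≤ s' ∨ s' ≤ s) → ∀ x, x - B.comb l ∈ c.lin →
      B.coeffs x = l := fun l h0 hl x hx =>
    ConeStratification.IsDecomp.coeffs_eq ⟨h0, hl, hx, fun s => Or.inr (hlin s _ hx)⟩
  have hco := fun x => ConeStratification.isDecomp_coeffs (A := B) x
  let σ : (Fin m → ℝ) → ℝ := fun y => ∑ s, B.coeffs (q y) s
  have hσ0 : ∀ y, 0 ≤ σ y := fun y => Finset.sum_nonneg fun s _ => (hco (q y)).nonneg s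
  have hσ : ∀ y, y ≠ 0 → 0 < σ y := by
    intro y hy
    refine lt_of_le_of_ne (hσ0 y) fun he => hy (hq0 y ?_)
    refine (ConeStratification.coeffs_eq_zero_iff (A := B)).1 (funext fun s => ?_)
    exact (Finset.sum_eq_zero_iff_of_nonneg fun s _ => (hco (q y)).nonneg s).1 he.symm s
      (Finset.mem_univ s)
  have hcq : Continuous fun y => B.coeffs (q y) :=
    ConeStratification.continuous_coeffs.comp q.continuous_of_finiteDimensional
  have hcσ : Continuous σ :=
    continuous_finsetSum _ fun s _ => (continuous_apply s).comp hcq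
  -- Rescaling along rays makes the total weight equal to the norm; at `y = 0` the factor is `0 / 0
  -- = 0`.
  let μ : (Fin m → ℝ) → ({c' : CellIndex d n // c' < c} → ℝ) := fun y =>
    (‖y‖ / σ y) • B.coeffs (q y)
  have hnn : ∀ y s, 0 ≤ μ y s := fun y s =>
    mul_nonneg (div_nonneg (norm_nonneg y) (hσ0 y)) ((hco (q y)).nonneg s)
  have hsum : ∀ y, ∑ s, μ y s = ‖y‖ := by
    intro y
    by_cases hy : y = 0
    · simp [μ, hy]
    · have : ∑ s, μ y s = ‖y‖ / σ y * σ y := by simp [μ, σ, Finset.mul_sum]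
      rw [this, div_mul_cancel₀ _ (hσ y hy).ne']
  refine ⟨μ, ?_, ?_, hnn, ?_, hsum, ?_⟩
  · rw [continuous_iff_continuousAt]
    intro y
    by_cases hy : y = 0
    · subst hy
      have h0 : μ 0 = 0 := by ext s; simp [μ]
      rw [ContinuousAt, h0]
      -- At the origin the quotient need not be continuous, but every coefficient is at most the
      -- total weight `‖y‖`.
      refine squeeze_zero_norm (a := norm) (fun y => ?_) tendsto_norm_zero
      rw [pi_norm_le_iff_of_nonneg (norm_nonneg y)]
      intro s
      rw [Real.norm_of_nonneg (hnn y s), ← hsum y]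
      exact Finset.single_le_sum (fun s _ => hnn y s) (Finset.mem_univ s)
    · exact (continuous_norm.continuousAt.div hcσ.continuousAt (hσ y hy).ne').smul
        hcq.continuousAt
  · intro y y' h
    have hnorm : ‖y‖ = ‖y'‖ := by rw [← hsum y, h, hsum y']
    by_cases hy : y = 0
    · subst hy
      rw [norm_zero] at hnorm
      exact (norm_eq_zero.1 hnorm.symm).symm
    have hy' : y' ≠ 0 := by
      rintro rfl
      rw [norm_zero] at hnorm
      exact hy (norm_eq_zero.1 hnorm)
    have ha : 0 < ‖y‖ / σ y := div_pos (norm_pos_iff.2 hy) (hσ y hy)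
    have ha' : 0 < ‖y'‖ / σ y' := div_pos (norm_pos_iff.2 hy') (hσ y' hy')
    set a := ‖y‖ / σ y
    set a' := ‖y'‖ / σ y'
    -- By homogeneity `a • y` and `a' • y'` have equal coefficients, so they agree modulo `c.lin`
    -- and hence agree; as `‖y‖ = ‖y'‖`, also `a = a'`.
    have he : B.coeffs (q (a • y)) = B.coeffs (q (a' • y')) := by
      rw [map_smul, map_smul, ConeStratification.coeffs_smul _ ha,
        ConeStratification.coeffs_smul _ ha']
      exact h
    have h1 : q (a • y) - B.comb (B.coeffs (q (a • y))) ∈ c.lin := (hco _).rem_mem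
    have h2 : q (a' • y') - B.comb (B.coeffs (q (a' • y'))) ∈ c.lin := (hco _).rem_mem
    rw [← he] at h2
    have h3 := sub_mem h1 h2
    rw [sub_sub_sub_cancel_right, ← map_sub] at h3
    have h4 := sub_eq_zero.1 (hq0 _ h3)
    have h5 := congrArg norm h4
    rw [norm_smul, norm_smul, ← hnorm, Real.norm_of_nonneg ha.le, Real.norm_of_nonneg ha'.le] at h5
    have h6 : a = a' := mul_right_cancel₀ (norm_ne_zero_iff.2 hy) h5
    rw [h6] at h4
    exact smul_right_injective _ ha'.ne' h4
  · intro y s s'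
    rcases (hco (q y)).chain s s' with h | h | h
    · exact Or.inl (by simp [μ, h])
    · exact Or.inr (Or.inl (by simp [μ, h]))
    · exact Or.inr (Or.inr h)
  · intro l h0 hl
    by_cases hl0 : l = 0
    · exact ⟨0, by rw [hl0]; simp [μ]⟩
    obtain ⟨y, hy⟩ := hqs (B.comb l)
    have hc : B.coeffs (q y) = l := by
      refine hdec l h0 hl _ ?_
      rw [← neg_sub]; exact neg_mem hy
    have hy0 : y ≠ 0 := by
      rintro rfl
      rw [map_zero] at hc
      exact hl0 (hc ▸ ConeStratification.coeffs_eq_zero_iff.2 B.zero_mem_rem)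
    have hr := hσ y hy0
    have hny := norm_pos_iff.2 hy0
    have ht : 0 < σ y / ‖y‖ := div_pos hr hny
    -- Here `σ y` is the sum of `l`, so `y` is rescaled to have that sum as its norm.
    refine ⟨(σ y / ‖y‖) • y, ?_⟩
    have hs : σ ((σ y / ‖y‖) • y) = σ y / ‖y‖ * σ y := by
      simp only [σ, map_smul, ConeStratification.coeffs_smul _ ht, Pi.smul_apply, smul_eq_mul,
        Finset.mul_sum]
    simp only [μ]
    rw [hs, map_smul, ConeStratification.coeffs_smul _ ht, hc, norm_smul,
      Real.norm_of_nonneg ht.le, smul_smul]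
    have : σ y / ‖y‖ * ‖y‖ / (σ y / ‖y‖ * σ y) * (σ y / ‖y‖) = 1 := by
      field_simp
    rw [this, one_smul]

/-! ### Barycentric coordinates and the order complex -/

/-- The linear combination of the vertices with coefficients `l`. -/
def comb (l : CellIndex d n → ℝ) : Config d n := ∑ c, l c • c.vertex

theorem comb_smul (t : ℝ) (l : CellIndex d n → ℝ) : comb (t • l) = t • comb l := by
  simp [comb, mul_smul, Finset.smul_sum]

theorem comb_add (l m : CellIndex d n → ℝ) : comb (l + m) = comb l + comb m := by
  simp [comb, add_smul, Finset.sum_add_distrib]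

theorem comb_sub (l m : CellIndex d n → ℝ) : comb (l - m) = comb l - comb m := by
  simp [comb, sub_smul, Finset.sum_sub_distrib]

theorem comb_single [DecidableEq (CellIndex d n)] (c : CellIndex d n) :
    comb (Pi.single c 1) = c.vertex := by
  simp [comb, Pi.single_apply]

theorem continuous_comb : Continuous (comb : (CellIndex d n → ℝ) → Config d n) := by
  unfold comb; fun_prop

/-- Nonnegative coefficients supported on a chain. -/
structure IsChainCoeff (l : CellIndex d n → ℝ) : Prop where
  nonneg : ∀ c, 0 ≤ l c
  chain : ∀ c c', l c = 0 ∨ l c' = 0 ∨ c ≤ c' ∨ c' ≤ c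

/-- Barycentric coordinates of a point in the order complex. -/
structure IsBary (l : CellIndex d n → ℝ) : Prop extends IsChainCoeff l where
  sum_eq : ∑ c, l c = 1

theorem IsBary.ne_zero {l : CellIndex d n → ℝ} (h : IsBary l) : l ≠ 0 := by
  rintro rfl
  simpa using h.sum_eq

theorem IsChainCoeff.isDecomp (hn : 2 ≤ n) {l : CellIndex d n → ℝ} (h : IsChainCoeff l) :
    (freeStratification d n hn).IsDecomp (comb l) l := by
  have h0 : comb l - (freeStratification d n hn).comb l = 0 := sub_self _
  refine ⟨h.nonneg, h.chain, ?_, fun c => Or.inr ?_⟩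
  · rw [h0]; exact (freeStratification d n hn).zero_mem_rem
  · rw [h0]; exact ConeStratification.zero_mem_closedCone c

/-- Such a combination is its own chain decomposition with residual 0, so this is uniqueness of
decompositions. It makes different simplices meet only in common faces. -/
theorem comb_injOn (hn : 2 ≤ n) {l m : CellIndex d n → ℝ} (hl : IsChainCoeff l)
    (hm : IsChainCoeff m) (h : comb l = comb m) : l = m :=
  (hl.isDecomp hn).unique (h ▸ hm.isDecomp hn)

theorem isBary_single [DecidableEq (CellIndex d n)] (c : CellIndex d n) :
    IsBary (Pi.single c (1 : ℝ)) := by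
  refine ⟨⟨fun a => ?_, fun a b => ?_⟩, by simp⟩
  · by_cases h : a = c
    · subst h; simp
    · simp [h]
  · by_cases h : a = c
    · by_cases h' : b = c
      · rw [h, h']; simp
      · simp [h']
    · simp [h]

theorem vertex_injective :
    Function.Injective (vertex : CellIndex d n → Config d n) := fun c c' h =>
  cone_eq_of_mem c.vertex_mem_cone (h ▸ c'.vertex_mem_cone)

theorem isBary_of_subset_chain {T : Set (CellIndex d n)} (hT : IsChain (· ≤ ·) T)
    {l : CellIndex d n → ℝ} (h0 : ∀ c, 0 ≤ l c) (hsum : ∑ c, l c = 1)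
    (hs : ∀ c, l c ≠ 0 → c ∈ T) : IsBary l := by
  refine ⟨⟨h0, fun a b => ?_⟩, hsum⟩
  by_cases ha : l a = 0
  · exact Or.inl ha
  by_cases hb : l b = 0
  · exact Or.inr (Or.inl hb)
  exact Or.inr (Or.inr (hT.total (hs a ha) (hs b hb)))

theorem IsChainCoeff.isChain_support {l : CellIndex d n → ℝ} (h : IsChainCoeff l) :
    IsChain (· ≤ ·) {c | l c ≠ 0} := by
  intro a ha b hb _
  rcases h.chain a b with h1 | h1 | h1
  · exact absurd h1 ha
  · exact absurd h1 hb
  · exact h1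

theorem mem_convexHull_vertex_image {T : Set (CellIndex d n)} {x : Config d n} :
    x ∈ convexHull ℝ (vertex '' T) ↔ ∃ l : CellIndex d n → ℝ, (∀ c, 0 ≤ l c) ∧
      ∑ c, l c = 1 ∧ (∀ c, l c ≠ 0 → c ∈ T) ∧ comb l = x := by
  classical
  constructor
  · intro hx
    have hconv : Convex ℝ {x : Config d n | ∃ l : CellIndex d n → ℝ, (∀ c, 0 ≤ l c) ∧
        ∑ c, l c = 1 ∧ (∀ c, l c ≠ 0 → c ∈ T) ∧ comb l = x} := by
      rintro _ ⟨l, hl0, hl1, hlT, rfl⟩ _ ⟨m, hm0, hm1, hmT, rfl⟩ a b ha hb hab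
      refine ⟨a • l + b • m, fun c => ?_, ?_, fun c hc => ?_, ?_⟩
      · exact add_nonneg (mul_nonneg ha (hl0 c)) (mul_nonneg hb (hm0 c))
      · simp [Finset.sum_add_distrib, ← Finset.mul_sum, hl1, hm1, hab]
      · by_contra hcT
        have h1 : l c = 0 := by by_contra h; exact hcT (hlT c h)
        have h2 : m c = 0 := by by_contra h; exact hcT (hmT c h)
        simp [h1, h2] at hc
      · rw [comb_add, comb_smul, comb_smul]
    refine convexHull_min ?_ hconv hx
    rintro _ ⟨c, hc, rfl⟩
    refine ⟨Pi.single c 1, (isBary_single c).nonneg, (isBary_single c).sum_eq, fun a ha => ?_,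
      comb_single c⟩
    by_cases h : a = c
    · rwa [h]
    · simp [h] at ha
  · rintro ⟨l, h0, h1, hT, rfl⟩
    have hcomb : comb l = ∑ c ∈ Finset.univ.filter (l · ≠ 0), l c • c.vertex := by
      rw [comb, Finset.sum_filter_of_ne]
      intro c _ hc h
      simp [h] at hc
    rw [hcomb]
    refine (convex_convexHull ℝ _).sum_mem (fun c _ => h0 c) ?_ fun c hc => ?_
    · rw [Finset.sum_filter_ne_zero, h1]
    · exact subset_convexHull ℝ _ ⟨c, hT c (Finset.mem_filter.1 hc).2, rfl⟩

/-- The positive and negative parts of a relation are nonnegative coefficients on the same chain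
with the same combination, so they coincide and the relation is trivial. -/
theorem linearIndepOn_vertex (hn : 2 ≤ n) {T : Set (CellIndex d n)} (hT : IsChain (· ≤ ·) T) :
    LinearIndepOn ℝ vertex T := by
  rw [linearIndepOn_iff]
  intro l hl h0
  have hmem : ∀ c, l c ≠ 0 → c ∈ T := fun c hc => by
    rw [Finsupp.mem_supported] at hl
    exact hl (by simpa using hc)
  have hcomb : comb (fun c => l c) = 0 := by
    rw [Finsupp.linearCombination_apply, Finsupp.sum_fintype _ _ (by simp)] at h0
    exact h0
  have key : ∀ f : ℝ → ℝ, (∀ t, 0 ≤ f t) → f 0 = 0 → IsChainCoeff fun c => f (l c) := by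
    intro f hf hf0
    refine ⟨fun c => hf _, fun a b => ?_⟩
    by_cases ha : l a = 0
    · exact Or.inl (by rw [ha, hf0])
    by_cases hb : l b = 0
    · exact Or.inr (Or.inl (by rw [hb, hf0]))
    exact Or.inr (Or.inr (hT.total (hmem a ha) (hmem b hb)))
  have hp := key (fun t => max t 0) (fun t => le_max_right _ _) (by simp)
  have hm := key (fun t => max (-t) 0) (fun t => le_max_right _ _) (by simp)
  have hsub : (fun c => l c) = (fun c => max (l c) 0) - fun c => max (-l c) 0 := by
    ext c
    exact (max_zero_sub_max_neg_zero_eq_self (l c)).symm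
  have heq := comb_injOn hn hp hm (by rw [← sub_eq_zero, ← comb_sub, ← hsub, hcomb])
  ext c
  have := congrFun hsub c
  rw [heq, sub_self] at this
  exact this

theorem IsChainCoeff.exists_greatest {l : CellIndex d n → ℝ} (h : IsChainCoeff l) (h0 : l ≠ 0) :
    ∃ c, l c ≠ 0 ∧ ∀ a, l a ≠ 0 → a ≤ c := by
  obtain ⟨s0, hs0⟩ : ∃ s, l s ≠ 0 := by
    by_contra! hc
    exact h0 (funext hc)
  obtain ⟨s, hs, hmax⟩ := (Set.toFinite {s | l s ≠ 0}).exists_maximal ⟨s0, hs0⟩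
  refine ⟨s, hs, fun a ha => ?_⟩
  rcases h.chain s a with h1 | h1 | h1 | h1
  · exact absurd h1 hs
  · exact absurd h1 ha
  · exact hmax ha h1
  · exact h1

/-- The geometric realization of the order complex of the poset of strings. -/
def orderComplex (d n : ℕ) (hn : 2 ≤ n) : Geometry.SimplicialComplex ℝ (Config d n) where
  faces := {s | ∃ T : Set (CellIndex d n), T.Nonempty ∧ IsChain (· ≤ ·) T ∧
    (s : Set (Config d n)) = vertex '' T}
  isRelLowerSet_faces := by
    rintro s ⟨T, hT, hchain, hs⟩
    refine ⟨?_, fun t hts ht => ?_⟩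
    · rw [← Finset.coe_nonempty, hs]; exact hT.image _
    · have hsub : (t : Set (Config d n)) ⊆ vertex '' T := by
        rw [← hs]; exact Finset.coe_subset.2 hts
      have himg : vertex '' (T ∩ vertex ⁻¹' (t : Set (Config d n))) = t := by
        rw [image_inter_preimage, inter_eq_right.2 hsub]
      refine ⟨T ∩ vertex ⁻¹' t, ?_, hchain.mono inter_subset_left, himg.symm⟩
      rw [← image_nonempty (f := vertex), himg]
      exact Finset.coe_nonempty.2 ht
  indep := by
    rintro s ⟨T, hT, hchain, hs⟩
    have h : LinearIndepOn ℝ id (vertex '' T) := (linearIndepOn_vertex hn hchain).id_image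
    rw [← hs] at h
    exact LinearIndependent.affineIndependent ℝ h
  inter_subset_convexHull := by
    rintro s t ⟨T, hT, hchain, hs⟩ ⟨T', hT', hchain', ht⟩ x ⟨hx, hx'⟩
    rw [hs] at hx
    rw [ht] at hx'
    obtain ⟨l, h0, h1, hl, rfl⟩ := mem_convexHull_vertex_image.1 hx
    obtain ⟨m, k0, k1, hm, hlm⟩ := mem_convexHull_vertex_image.1 hx'
    -- The two coordinate vectors of `x` agree, so their support lies in both chains.
    have := comb_injOn hn (isBary_of_subset_chain hchain' k0 k1 hm).toIsChainCoeff
      (isBary_of_subset_chain hchain h0 h1 hl).toIsChainCoeff hlm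
    subst this
    rw [hs, ht]
    exact convexHull_mono (image_inter_subset _ _ _) (mem_convexHull_vertex_image.2
      ⟨m, h0, h1, fun c hc => ⟨hl c hc, hm c hc⟩, rfl⟩)

theorem mem_space_orderComplex (hn : 2 ≤ n) {x : Config d n} :
    x ∈ (orderComplex d n hn).space ↔ ∃ l, IsBary l ∧ comb l = x := by
  rw [Geometry.SimplicialComplex.mem_space_iff]
  constructor
  · rintro ⟨s, ⟨T, -, hT, hs⟩, hx⟩
    rw [hs] at hx
    obtain ⟨l, h0, h1, hl, rfl⟩ := mem_convexHull_vertex_image.1 hx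
    exact ⟨l, isBary_of_subset_chain hT h0 h1 hl, rfl⟩
  · rintro ⟨l, hl, rfl⟩
    classical
    refine ⟨(Set.toFinite (vertex '' {c | l c ≠ 0})).toFinset, ⟨{c | l c ≠ 0}, ?_,
      hl.isChain_support, by simp⟩, ?_⟩
    · by_contra hne
      rw [not_nonempty_iff_eq_empty, eq_empty_iff_forall_notMem] at hne
      exact hl.ne_zero (funext fun c => not_not.1 (hne c))
    · rw [Set.Finite.coe_toFinset]
      exact mem_convexHull_vertex_image.2 ⟨l, hl.nonneg, hl.sum_eq, fun c hc => hc, rfl⟩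

/-- The closed cell of `c`. -/
def cellSet (c : CellIndex d n) : Set (Config d n) :=
  comb '' {l | IsBary l ∧ ∀ a, l a ≠ 0 → a ≤ c}

theorem cellSet_eq_iUnion (c : CellIndex d n) :
    c.cellSet = ⋃ T ∈ {T : Set (CellIndex d n) | IsChain (· ≤ ·) T ∧ ∀ a ∈ T, a ≤ c},
      convexHull ℝ (vertex '' T) := by
  ext x
  simp only [mem_iUnion, exists_prop, mem_convexHull_vertex_image]
  constructor
  · rintro ⟨l, ⟨hl, hle⟩, rfl⟩
    exact ⟨{c | l c ≠ 0}, ⟨hl.isChain_support, hle⟩, l, hl.nonneg, hl.sum_eq, fun c hc => hc, rfl⟩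
  · rintro ⟨T, ⟨hT, hle⟩, l, h0, h1, hl, rfl⟩
    exact ⟨l, ⟨isBary_of_subset_chain hT h0 h1 hl, fun a ha => hle a (hl a ha)⟩, rfl⟩

theorem vertex_mem_cellSet (c : CellIndex d n) : c.vertex ∈ c.cellSet := by
  classical
  refine ⟨Pi.single c 1, ⟨isBary_single c, fun a ha => ?_⟩, comb_single c⟩
  by_cases h : a = c
  · rw [h]
  · simp [h] at ha

theorem cellSet_subset_iff (hn : 2 ≤ n) {c c' : CellIndex d n} :
    c.cellSet ⊆ c'.cellSet ↔ c ≤ c' := by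
  classical
  constructor
  · intro h
    obtain ⟨l, ⟨hl, hle⟩, hv⟩ := h c.vertex_mem_cellSet
    have := comb_injOn hn hl.toIsChainCoeff (isBary_single c).toIsChainCoeff
      (hv.trans (comb_single c).symm)
    exact hle c (by rw [this]; simp)
  · rintro h _ ⟨l, ⟨hl, hle⟩, rfl⟩
    exact ⟨l, ⟨hl, fun a ha => (hle a ha).trans h⟩, rfl⟩

theorem cellSet_subset_space (hn : 2 ≤ n) (c : CellIndex d n) :
    c.cellSet ⊆ (orderComplex d n hn).space := by
  rintro _ ⟨l, ⟨hl, -⟩, rfl⟩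
  exact (mem_space_orderComplex hn).2 ⟨l, hl, rfl⟩

theorem iUnion_cellSet (hn : 2 ≤ n) :
    ⋃ c : CellIndex d n, c.cellSet = (orderComplex d n hn).space := by
  refine (iUnion_subset (cellSet_subset_space hn)).antisymm fun x hx => ?_
  obtain ⟨l, hl, rfl⟩ := (mem_space_orderComplex hn).1 hx
  obtain ⟨c, -, hc⟩ := hl.exists_greatest hl.ne_zero
  exact mem_iUnion.2 ⟨c, l, ⟨hl, hc⟩, rfl⟩

theorem isCompact_space_orderComplex (hn : 2 ≤ n) : IsCompact (orderComplex d n hn).space := by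
  have hfin : (orderComplex d n hn).faces.Finite := by
    refine Set.Finite.subset (Set.toFinite (Finset.univ.image (vertex (d := d) (n := n))).powerset)
      ?_
    rintro s ⟨T, -, -, hs⟩
    rw [Finset.mem_coe, Finset.mem_powerset, ← Finset.coe_subset, hs]
    rintro _ ⟨c, -, rfl⟩
    simp
  exact hfin.isCompact_biUnion fun s _ => s.finite_toSet.isCompact_convexHull ℝ

/-! ### The action of the symmetric group -/

/-- The action of a permutation as a linear map. -/
def permMap (π : Equiv.Perm (Fin n)) : Config d n →ₗ[ℝ] Config d n where
  toFun x := π • x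
  map_add' _ _ := rfl
  map_smul' _ _ := rfl

theorem smul_apply (π : Equiv.Perm (Fin n)) (x : Config d n) (a : Fin n) :
    (π • x) a = x (π⁻¹ a) := rfl

theorem smul_le_smul_iff (π : Equiv.Perm (Fin n)) (c c' : CellIndex d n) :
    π • c ≤ π • c' ↔ c ≤ c' := by
  have key : ∀ (π : Equiv.Perm (Fin n)) (c c' : CellIndex d n), c ≤ c' → π • c ≤ π • c' :=
    fun π c c' h a b q hq => h (π⁻¹ a) (π⁻¹ b) q hq
  refine ⟨fun h => ?_, key π c c'⟩
  simpa using key π⁻¹ _ _ h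

theorem vertex_smul (π : Equiv.Perm (Fin n)) (c : CellIndex d n) :
    (π • c).vertex = π • c.vertex := by
  have h : (π • c).preVertex = π • c.preVertex := rfl
  rw [vertex, vertex, h]
  ext a : 1
  simp only [recenter, smul_apply]
  rw [Equiv.sum_comp π⁻¹ (fun k => c.preVertex k)]

theorem smul_comb (π : Equiv.Perm (Fin n)) (l : CellIndex d n → ℝ) :
    π • comb l = comb fun c => l (π⁻¹ • c) := by
  change permMap π (comb l) = _
  rw [comb, map_sum, comb, ← Equiv.sum_comp (MulAction.toPerm π) fun c => l (π⁻¹ • c) • c.vertex]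
  refine Finset.sum_congr rfl fun c _ => ?_
  rw [map_smul, MulAction.toPerm_apply, inv_smul_smul, vertex_smul]
  rfl

theorem IsChainCoeff.smul {l : CellIndex d n → ℝ} (h : IsChainCoeff l)
    (π : Equiv.Perm (Fin n)) : IsChainCoeff fun c => l (π⁻¹ • c) :=
  ⟨fun _ => h.nonneg _, fun a b => by
    have := h.chain (π⁻¹ • a) (π⁻¹ • b)
    rwa [smul_le_smul_iff, smul_le_smul_iff] at this⟩

theorem IsBary.smul {l : CellIndex d n → ℝ} (h : IsBary l) (π : Equiv.Perm (Fin n)) :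
    IsBary fun c => l (π⁻¹ • c) :=
  ⟨h.toIsChainCoeff.smul π, (Equiv.sum_comp (MulAction.toPerm π⁻¹) l).trans h.sum_eq⟩

theorem smul_image_cellSet (π : Equiv.Perm (Fin n)) (c : CellIndex d n) :
    (fun x => π • x) '' c.cellSet = (π • c).cellSet := by
  have key : ∀ (π : Equiv.Perm (Fin n)) (c : CellIndex d n),
      (fun x => π • x) '' c.cellSet ⊆ (π • c).cellSet := by
    rintro π c _ ⟨_, ⟨l, ⟨hl, hle⟩, rfl⟩, rfl⟩
    refine ⟨_, ⟨hl.smul π, fun a ha => ?_⟩, (smul_comb π l).symm⟩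
    have := (smul_le_smul_iff π _ _).2 (hle _ ha)
    rwa [smul_inv_smul] at this
  refine (key π c).antisymm fun x hx => ⟨π⁻¹ • x, ?_, smul_inv_smul π x⟩
  have := key π⁻¹ (π • c) ⟨x, hx, rfl⟩
  rwa [inv_smul_smul] at this

theorem smul_mem_confSpace_iff (π : Equiv.Perm (Fin n)) {x : Config d n} :
    π • x ∈ confSpace d n ↔ x ∈ confSpace d n := by
  have key : ∀ (π : Equiv.Perm (Fin n)) (x : Config d n), x ∈ confSpace d n →
      π • x ∈ confSpace d n := fun π x hx j k hjk =>
    hx (π⁻¹ j) (π⁻¹ k) fun h => hjk (π⁻¹.injective h)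
  refine ⟨fun h => ?_, key π x⟩
  simpa using key π⁻¹ _ h

theorem smul_mem_ccone (π : Equiv.Perm (Fin n)) {c : CellIndex d n} {x : Config d n}
    (hx : x ∈ c.ccone) : π • x ∈ (π • c).ccone := by
  have hl : ∀ j, π⁻¹ ((π • c).left j) = c.left j := fun j => π.symm_apply_apply _
  have hr : ∀ j, π⁻¹ ((π • c).right j) = c.right j := fun j => π.symm_apply_apply _
  refine ⟨fun j t ht => ?_, fun j => ?_⟩
  · rw [smul_apply, smul_apply, hl, hr]; exact hx.1 j t ht
  · rw [gap_apply, smul_apply, smul_apply, hl, hr]; exact hx.2 j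

/-- The permuted decomposition is a decomposition of the permuted configuration; uniqueness does the
rest. -/
theorem coeffs_smul_perm (hn : 2 ≤ n) (π : Equiv.Perm (Fin n)) (x : Config d n) :
    (freeStratification d n hn).coeffs (π • x) =
      fun c => (freeStratification d n hn).coeffs x (π⁻¹ • c) := by
  obtain ⟨h1, h2, h3, h4⟩ := ConeStratification.isDecomp_coeffs (A := freeStratification d n hn) x
  have hl : IsChainCoeff ((freeStratification d n hn).coeffs x) := ⟨h1, h2⟩
  have hsub : ∀ l : CellIndex d n → ℝ, π • x - (freeStratification d n hn).comb
      (fun c => l (π⁻¹ • c)) = π • (x - (freeStratification d n hn).comb l) := fun l => by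
    change _ - comb _ = _
    rw [← smul_comb]
    rfl
  refine ConeStratification.IsDecomp.coeffs_eq ⟨(hl.smul π).nonneg, (hl.smul π).chain, ?_,
    fun c => (h4 (π⁻¹ • c)).imp id fun h => ?_⟩
  · rw [hsub]
    exact fun h => h3 ((smul_mem_confSpace_iff π).1 h)
  · rw [hsub]
    have := smul_mem_ccone π (c := π⁻¹ • c) ⟨h.1, fun j => h.2 j (Finset.mem_univ j)⟩
    rw [smul_inv_smul] at this
    exact ⟨this.1, fun j _ => this.2 j⟩

end CellIndex


/-! ### The equivariant deformation retraction -/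

/-- An equivariant retraction along straight lines is a strong deformation retraction. -/
theorem isEquivariantStrongDeformationRetract_of_segment {G E : Type*} [Group G]
    [NormedAddCommGroup E] [NormedSpace ℝ E] [MulAction G E] {A X : Set E} (hAX : A ⊆ X)
    (hX : ∀ g : G, ∀ x ∈ X, g • x ∈ X) (hA : ∀ g : G, ∀ x ∈ A, g • x ∈ A)
    (hlin : ∀ (g : G) (a b : ℝ) (x y : E), g • (a • x + b • y) = a • g • x + b • g • y)
    {r : E → E} (hr : ContinuousOn r X) (hrA : ∀ x ∈ X, r x ∈ A) (hrid : ∀ x ∈ A, r x = x)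
    (hrg : ∀ (g : G) (x : E), r (g • x) = g • r x)
    (hseg : ∀ x ∈ X, ∀ t : ℝ, 0 ≤ t → t ≤ 1 → (1 - t) • x + t • r x ∈ X) :
    IsEquivariantStrongDeformationRetract G A X := by
  have hcr : Continuous fun x : X => r x := continuousOn_iff_continuous_domRestrict.1 hr
  have hcH : Continuous fun p : unitInterval × X =>
      (1 - (p.1 : ℝ)) • (p.2 : E) + (p.1 : ℝ) • r p.2 := by
    have hr' : Continuous fun p : unitInterval × X => r p.2 := hcr.comp continuous_snd
    have ht : Continuous fun p : unitInterval × X => (p.1 : ℝ) := by fun_prop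
    have hx : Continuous fun p : unitInterval × X => (p.2 : E) := by fun_prop
    exact ((continuous_const.sub ht).smul hx).add (ht.smul hr')
  refine ⟨hAX, hX, hA, ⟨fun x => ⟨r x, hAX (hrA x x.2)⟩, hcr.subtype_mk _⟩,
    { toFun := fun p => ⟨(1 - (p.1 : ℝ)) • (p.2 : E) + (p.1 : ℝ) • r p.2,
        hseg _ p.2.2 _ p.1.2.1 p.1.2.2⟩
      continuous_toFun := hcH.subtype_mk _
      map_zero_left := fun x => Subtype.ext (by simp)
      map_one_left := fun x => Subtype.ext (by simp)
      prop' := fun t x hx => Subtype.ext ?_ }, fun x => hrA x x.2, fun g t x y hxy => ?_⟩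
  · change (1 - (t : ℝ)) • (x : E) + (t : ℝ) • r x = x
    rw [hrid x hx, ← add_smul, sub_add_cancel, one_smul]
  · change (1 - (t : ℝ)) • (y : E) + (t : ℝ) • r y =
      g • ((1 - (t : ℝ)) • (x : E) + (t : ℝ) • r x)
    rw [hxy, hrg, hlin]

theorem Finset.sum_nat_eq_one_iff {ι : Type*} {s : Finset ι} {f : ι → ℕ} :
    ∑ i ∈ s, f i = 1 ↔ ∃ k ∈ s, f k = 1 ∧ ∀ j ∈ s, j ≠ k → f j = 0 := by
  classical
  constructor
  · intro h
    obtain ⟨k, hk, hk0⟩ := Finset.exists_ne_zero_of_sum_ne_zero (h ▸ one_ne_zero : ∑ i ∈ s, f i ≠ 0)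
    rw [← Finset.add_sum_erase s f hk] at h
    have h0 : ∑ i ∈ s.erase k, f i = 0 := by omega
    exact ⟨k, hk, by omega, fun j hj hjk =>
      Finset.sum_eq_zero_iff.1 h0 j (Finset.mem_erase.2 ⟨hjk, hj⟩)⟩
  · rintro ⟨k, hk, h1, h0⟩
    rw [Finset.sum_eq_single_of_mem k hk h0, h1]

namespace CellIndex

variable {d n : ℕ}

theorem IsChainCoeff.comb_mem_cone (hn : 2 ≤ n) {l : CellIndex d n → ℝ} (h : IsChainCoeff l)
    (h0 : l ≠ 0) : ∃ c, l c ≠ 0 ∧ comb l ∈ c.cone := by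
  obtain ⟨c, hc, -, h1, h2⟩ := (h.isDecomp hn).exists_least h0
  exact ⟨c, hc, h1, fun j => h2 j (Finset.mem_univ j)⟩

theorem space_subset_confSpace (hn : 2 ≤ n) :
    (orderComplex d n hn).space ⊆ confSpace d n := by
  intro x hx
  obtain ⟨l, hl, rfl⟩ := (mem_space_orderComplex hn).1 hx
  obtain ⟨c, -, hc⟩ := hl.comb_mem_cone hn hl.ne_zero
  exact cone_subset_confSpace c hc

theorem smul_mem_space (hn : 2 ≤ n) (π : Equiv.Perm (Fin n)) {x : Config d n}
    (hx : x ∈ (orderComplex d n hn).space) : π • x ∈ (orderComplex d n hn).space := by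
  obtain ⟨l, hl, rfl⟩ := (mem_space_orderComplex hn).1 hx
  exact (mem_space_orderComplex hn).2 ⟨_, hl.smul π, (smul_comb π l).symm⟩

/-- The sum of the coefficients of a configuration in the Fox–Neuwirth stratification. -/
def weight (hn : 2 ≤ n) (x : Config d n) : ℝ := ∑ c, (freeStratification d n hn).coeffs x c

/-- The retraction of the configuration space to the order complex. -/
def retract (hn : 2 ≤ n) (x : Config d n) : Config d n :=
  (weight hn x)⁻¹ • comb ((freeStratification d n hn).coeffs x)

theorem isChainCoeff_coeffs (hn : 2 ≤ n) (x : Config d n) :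
    IsChainCoeff ((freeStratification d n hn).coeffs x) :=
  ⟨(ConeStratification.isDecomp_coeffs x).nonneg, (ConeStratification.isDecomp_coeffs x).chain⟩

theorem coeffs_ne_zero (hn : 2 ≤ n) {x : Config d n} (hx : x ∈ confSpace d n) :
    (freeStratification d n hn).coeffs x ≠ 0 := fun h =>
  (ConeStratification.coeffs_eq_zero_iff (A := freeStratification d n hn)).1 h hx

theorem weight_pos (hn : 2 ≤ n) {x : Config d n} (hx : x ∈ confSpace d n) : 0 < weight hn x := by
  have h0 := (isChainCoeff_coeffs hn x).nonneg
  refine lt_of_le_of_ne (Finset.sum_nonneg fun c _ => h0 c) fun he => coeffs_ne_zero hn hx ?_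
  exact funext fun c =>
    (Finset.sum_eq_zero_iff_of_nonneg fun c _ => h0 c).1 he.symm c (Finset.mem_univ c)

theorem continuous_coeffs (hn : 2 ≤ n) : Continuous (freeStratification d n hn).coeffs :=
  ConeStratification.continuous_coeffs

theorem continuousOn_retract (hn : 2 ≤ n) : ContinuousOn (retract hn) (confSpace d n) := by
  have hw : Continuous (weight (d := d) hn) :=
    continuous_finsetSum _ fun c _ => (continuous_apply c).comp (continuous_coeffs hn)
  exact (hw.continuousOn.inv₀ fun x hx => (weight_pos hn hx).ne').smul
    (continuous_comb.comp (continuous_coeffs hn)).continuousOn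

theorem retract_mem_space (hn : 2 ≤ n) {x : Config d n} (hx : x ∈ confSpace d n) :
    retract hn x ∈ (orderComplex d n hn).space := by
  have hw := weight_pos hn hx
  have hl := isChainCoeff_coeffs hn x
  refine (mem_space_orderComplex hn).2
    ⟨(weight hn x)⁻¹ • (freeStratification d n hn).coeffs x, ⟨⟨fun c => ?_, fun a b => ?_⟩, ?_⟩,
      comb_smul _ _⟩
  · exact mul_nonneg (inv_nonneg.2 hw.le) (hl.nonneg c)
  · rcases hl.chain a b with h | h | h
    · exact Or.inl (by simp [h])
    · exact Or.inr (Or.inl (by simp [h]))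
    · exact Or.inr (Or.inr h)
  · simp only [Pi.smul_apply, smul_eq_mul, ← Finset.mul_sum]
    exact inv_mul_cancel₀ hw.ne'

theorem retract_of_mem_space (hn : 2 ≤ n) {x : Config d n}
    (hx : x ∈ (orderComplex d n hn).space) : retract hn x = x := by
  obtain ⟨l, hl, rfl⟩ := (mem_space_orderComplex hn).1 hx
  have hc := (hl.isDecomp hn).coeffs_eq
  rw [retract, weight, hc, hl.sum_eq, inv_one, one_smul]

theorem retract_smul (hn : 2 ≤ n) (π : Equiv.Perm (Fin n)) (x : Config d n) :
    retract hn (π • x) = π • retract hn x := by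
  have hw : weight hn (π • x) = weight hn x := by
    rw [weight, coeffs_smul_perm]
    exact Equiv.sum_comp (MulAction.toPerm π⁻¹) _
  rw [retract, hw, coeffs_smul_perm, ← smul_comb]
  exact ((permMap π).map_smul _ _).symm

/-- Both endpoints lie in the cone of the least string in the support of the coefficients, and that
cone is convex. -/
theorem segment_mem_confSpace (hn : 2 ≤ n) {x : Config d n} (hx : x ∈ confSpace d n) {t : ℝ}
    (h0 : 0 ≤ t) (h1 : t ≤ 1) : (1 - t) • x + t • retract hn x ∈ confSpace d n := by
  have hw := weight_pos hn hx
  have hd := ConeStratification.isDecomp_coeffs (A := freeStratification d n hn) x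
  obtain ⟨c, hc, hle, hxc⟩ := hd.exists_least (coeffs_ne_zero hn hx)
  have hcone : ∀ y, y ∈ (freeStratification d n hn).openCone c → y ∈ c.cone :=
    fun y hy => ⟨hy.1, fun j => hy.2 j (Finset.mem_univ j)⟩
  have hr : retract hn x ∈ c.cone := by
    refine smul_mem_cone (hcone _ ?_) (inv_pos.2 hw)
    have := ConeStratification.add_comb_mem_openCone (A := freeStratification d n hn) (r := 0)
      hd.nonneg hc hle (ConeStratification.zero_mem_closedCone c)
    rwa [add_zero] at this
  rcases h0.eq_or_lt with rfl | ht
  · simpa using hx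
  · refine cone_subset_confSpace c (add_smul_mem_cone ?_ hr ht)
    have hx' := cone_subset_ccone c (hcone x hxc)
    exact ⟨Submodule.smul_mem _ _ hx'.1, fun j => by
      rw [map_smul]; exact mul_nonneg (by linarith) (hx'.2 j)⟩

theorem isEquivariantStrongDeformationRetract (hn : 2 ≤ n) :
    IsEquivariantStrongDeformationRetract (Equiv.Perm (Fin n)) (orderComplex d n hn).space
      (confSpace d n) :=
  isEquivariantStrongDeformationRetract_of_segment (space_subset_confSpace hn)
    (fun π _ hx => (smul_mem_confSpace_iff π).2 hx) (fun π _ hx => smul_mem_space hn π hx)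
    (fun π a b x y => by
      change permMap π (a • x + b • y) = _
      rw [map_add, map_smul, map_smul]
      rfl)
    (continuousOn_retract hn) (fun _ hx => retract_mem_space hn hx)
    (fun _ hx => retract_of_mem_space hn hx) (retract_smul hn)
    fun _ hx _ h0 h1 => segment_mem_confSpace hn hx h0 h1

theorem recenter_mem_sumZero (hn : 2 ≤ n) (x : Config d n) : recenter x ∈ sumZero d n := by
  have hn0 : (n : ℝ) ≠ 0 := by positivity
  change ∑ k, (x k - (1 / (n : ℝ)) • ∑ k, x k) = 0
  rw [Finset.sum_sub_distrib, Finset.sum_const, Finset.card_univ, Fintype.card_fin,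
    ← Nat.cast_smul_eq_nsmul ℝ, smul_smul, mul_one_div_cancel hn0, one_smul, sub_self]

/-- The difference `x - recenter x` has all columns equal, hence is orthogonal to every matrix whose
columns sum to zero. -/
theorem recenter_eq_starProjection (hn : 2 ≤ n) (x : Config d n) :
    recenter x = (sumZero d n).starProjection x := by
  refine (Submodule.eq_starProjection_of_mem_of_inner_eq_zero (recenter_mem_sumZero hn x)
    fun w hw => ?_).symm
  have h : ∀ k, (x - recenter x) k = (1 / (n : ℝ)) • ∑ k, x k := fun k => by simp [recenter]
  have hw' : ∑ k, w k = 0 := hw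
  rw [PiLp.inner_apply]
  simp only [h]
  rw [← inner_sum, hw', inner_zero_right]

theorem space_subset_sumZero (hn : 2 ≤ n) :
    (orderComplex d n hn).space ⊆ (sumZero d n : Set (Config d n)) := by
  intro x hx
  obtain ⟨l, -, rfl⟩ := (mem_space_orderComplex hn).1 hx
  exact sum_mem fun c _ => Submodule.smul_mem _ _ (recenter_mem_sumZero hn _)

/-! ### Counting the cells -/

theorem dim_le (c : CellIndex d n) : c.dim ≤ (d - 1) * (n - 1) := by
  have : c.dim ≤ ∑ _j : Fin (n - 1), (d - 1) :=
    Finset.sum_le_sum fun j _ => Nat.le_sub_one_of_lt (c.idx j).isLt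
  simpa [mul_comm] using this

theorem dim_eq_iff (hd : 1 ≤ d) (c : CellIndex d n) :
    c.dim = (d - 1) * (n - 1) ↔ ∀ j, c.idx j = ⟨d - 1, by omega⟩ := by
  have h : (d - 1) * (n - 1) = ∑ _j : Fin (n - 1), (d - 1) := by simp [mul_comm]
  rw [h, dim, Finset.sum_eq_sum_iff_of_le fun j _ => Nat.le_sub_one_of_lt (c.idx j).isLt]
  simp [Fin.ext_iff]

theorem dim_eq_zero_iff (hd : 1 ≤ d) (c : CellIndex d n) :
    c.dim = 0 ↔ ∀ j, c.idx j = ⟨0, by omega⟩ := by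
  simp [dim, Fin.ext_iff]

theorem card_const (i : Fin d) :
    Nat.card {c : CellIndex d n // ∀ j, c.idx j = i} = n.factorial := by
  let e : {c : CellIndex d n // ∀ j, c.idx j = i} ≃ Equiv.Perm (Fin n) :=
    { toFun := fun c => c.1.perm
      invFun := fun σ => ⟨⟨σ, fun _ => i⟩, fun _ => rfl⟩
      left_inv := fun c => Subtype.ext (CellIndex.ext rfl (funext fun j => (c.2 j).symm))
      right_inv := fun _ => rfl }
  rw [Nat.card_congr e, Nat.card_perm, Nat.card_eq_fintype_card, Fintype.card_fin]

theorem dim_eq_sub_one_iff (hd : 2 ≤ d) (hn : 2 ≤ n) (c : CellIndex d n) :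
    c.dim = (d - 1) * (n - 1) - 1 ↔ ∃ k, c.idx = fun j =>
      if j = k then ⟨d - 2, by omega⟩ else ⟨d - 1, by omega⟩ := by
  have hle : ∀ j, (c.idx j : ℕ) ≤ d - 1 := fun j => Nat.le_sub_one_of_lt (c.idx j).isLt
  have hsum : c.dim + ∑ j, (d - 1 - (c.idx j : ℕ)) = (d - 1) * (n - 1) := by
    rw [dim, ← Finset.sum_add_distrib, Finset.sum_congr rfl fun j _ => Nat.add_sub_of_le (hle j)]
    simp [mul_comm]
  -- Positivity makes the truncated subtraction of 1 genuine, so codimension one means a total index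
  -- defect of 1, located at a single position.
  have hpos : 0 < (d - 1) * (n - 1) := Nat.mul_pos (by omega) (by omega)
  have h1 : c.dim = (d - 1) * (n - 1) - 1 ↔ ∑ j, (d - 1 - (c.idx j : ℕ)) = 1 := by omega
  rw [h1, Finset.sum_nat_eq_one_iff]
  constructor
  · rintro ⟨k, -, hk, hne⟩
    refine ⟨k, funext fun j => Fin.ext ?_⟩
    by_cases hj : j = k
    · subst hj
      have := hle j
      simp only [if_true]
      omega
    · have := hne j (Finset.mem_univ j) hj
      have := hle j
      simp only [hj, if_false]
      omega
  · rintro ⟨k, hk⟩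
    refine ⟨k, Finset.mem_univ k, ?_, fun j _ hj => ?_⟩
    · rw [hk]; simp only [if_true]; omega
    · rw [hk]; simp [hj]

theorem card_dim_eq_sub_one (hd : 2 ≤ d) (hn : 2 ≤ n) :
    Nat.card {c : CellIndex d n // c.dim = (d - 1) * (n - 1) - 1} = (n - 1) * n.factorial := by
  let f : Fin (n - 1) × Equiv.Perm (Fin n) →
      {c : CellIndex d n // c.dim = (d - 1) * (n - 1) - 1} := fun p =>
    ⟨⟨p.2, fun j => if j = p.1 then ⟨d - 2, by omega⟩ else ⟨d - 1, by omega⟩⟩,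
      (dim_eq_sub_one_iff hd hn _).2 ⟨p.1, rfl⟩⟩
  have hf : Function.Bijective f := by
    constructor
    · rintro ⟨k, σ⟩ ⟨k', σ'⟩ h
      have h' := Subtype.ext_iff.1 h
      have h1 : σ = σ' := congrArg CellIndex.perm h'
      have h2 := congrFun (congrArg CellIndex.idx h') k
      refine Prod.ext ?_ h1
      by_contra hne
      have hne' : k ≠ k' := hne
      simp only [f, if_true, hne', if_false, Fin.mk.injEq] at h2
      omega
    · rintro ⟨c, hc⟩
      obtain ⟨k, hk⟩ := (dim_eq_sub_one_iff hd hn c).1 hc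
      exact ⟨(k, c.perm), Subtype.ext (CellIndex.ext rfl hk.symm)⟩
  rw [← Nat.card_congr (Equiv.ofBijective f hf), Nat.card_prod, Nat.card_perm]
  simp

/-- Raising every index to its largest value gives a larger string, so a maximal one has top
dimension; conversely dimension increases strictly along the order and is bounded. -/
theorem isMax_iff (hd : 1 ≤ d) (c : CellIndex d n) :
    IsMax c ↔ c.dim = (d - 1) * (n - 1) := by
  constructor
  · intro h
    by_contra hne
    rw [dim_eq_iff hd] at hne
    have hle : c ≤ ⟨c.perm, fun _ => ⟨d - 1, by omega⟩⟩ := fun a b q hq =>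
      Or.inl ⟨q, hq, index_le_iff.2 (Fin.le_def.2 (Nat.le_sub_one_of_lt (c.idx q).isLt))⟩
    have := le_antisymm hle (h hle)
    exact hne fun j => congrFun (congrArg CellIndex.idx this) j
  · intro h c' hc'
    rcases hc'.lt_or_eq with hlt | rfl
    · have := dim_lt_of_lt hlt
      have := c'.dim_le
      omega
    · exact le_rfl

end CellIndex


/-! ### Characteristic maps and the CW structure -/

/-- Inverses stay in the compact set `K`, and injectivity on `K` leaves only one possible cluster
point. This supplies the continuous inverse on each open cell. -/
theorem IsCompact.continuousOn_invFunOn {X Y : Type*} [TopologicalSpace X] [TopologicalSpace Y]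
    [T2Space Y] [Nonempty X] {f : X → Y} {s K : Set X} (hK : IsCompact K) (hsK : s ⊆ K)
    (hf : ContinuousOn f K) (hinj : InjOn f K) :
    ContinuousOn (Function.invFunOn f s) (f '' s) := by
  rintro _ ⟨x, hx, rfl⟩
  have hinv : ∀ y ∈ f '' s, Function.invFunOn f s y ∈ s ∧ f (Function.invFunOn f s y) = y :=
    fun y hy => ⟨Function.invFunOn_mem hy, Function.invFunOn_eq hy⟩
  have hx' : Function.invFunOn f s (f x) = x :=
    hinj (hsK (hinv _ ⟨x, hx, rfl⟩).1) (hsK hx) (hinv _ ⟨x, hx, rfl⟩).2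
  rw [ContinuousWithinAt, hx']
  refine hK.tendsto_nhds_of_unique_mapClusterPt ?_ fun a ha hcl => ?_
  · filter_upwards [self_mem_nhdsWithin] with y hy
    exact hsK (hinv y hy).1
  · obtain ⟨U, hU, hUa⟩ := mapClusterPt_iff_ultrafilter.1 hcl
    have hmem : ∀ᶠ y in (U : Filter Y), y ∈ f '' s := hU self_mem_nhdsWithin
    have h1 : Tendsto (fun y => f (Function.invFunOn f s y)) U (𝓝 (f a)) := by
      refine (hf a ha).tendsto.comp (tendsto_nhdsWithin_iff.2 ⟨hUa, ?_⟩)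
      filter_upwards [hmem] with y hy
      exact hsK (hinv y hy).1
    have h2 : Tendsto (fun y => f (Function.invFunOn f s y)) U (𝓝 (f x)) := by
      refine Tendsto.congr' ?_ (tendsto_id'.2 (hU.trans nhdsWithin_le_nhds))
      filter_upwards [hmem] with y hy
      exact (hinv y hy).2.symm
    exact hinj ha (hsK hx) (tendsto_nhds_unique h1 h2)

namespace CellIndex

variable {d n : ℕ}

open Classical in
/-- Extension of coefficients on the proper faces of `c` by the coefficient `r` at `c`. -/
def extendCoeff (c : CellIndex d n) (l : {c' : CellIndex d n // c' < c} → ℝ) (r : ℝ)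
    (a : CellIndex d n) : ℝ :=
  if h : a < c then l ⟨a, h⟩ else if a = c then r else 0

theorem extendCoeff_of_lt {c a : CellIndex d n} (h : a < c)
    (l : {c' : CellIndex d n // c' < c} → ℝ) (r : ℝ) : c.extendCoeff l r a = l ⟨a, h⟩ := by
  simp [extendCoeff, h]

theorem extendCoeff_self (c : CellIndex d n) (l : {c' : CellIndex d n // c' < c} → ℝ) (r : ℝ) :
    c.extendCoeff l r c = r := by
  simp [extendCoeff]

theorem le_of_extendCoeff_ne_zero {c a : CellIndex d n} {l : {c' : CellIndex d n // c' < c} → ℝ}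
    {r : ℝ} (h : c.extendCoeff l r a ≠ 0) : a ≤ c := by
  by_contra hle
  have h1 : ¬ a < c := fun h => hle h.le
  have h2 : a ≠ c := fun h => hle h.le
  simp [extendCoeff, h1, h2] at h

theorem sum_extendCoeff (c : CellIndex d n) (l : {c' : CellIndex d n // c' < c} → ℝ) (r : ℝ) :
    ∑ a, c.extendCoeff l r a = ∑ s, l s + r := by
  classical
  have h1 : ∀ a, c.extendCoeff l r a =
      (if h : a < c then l ⟨a, h⟩ else 0) + if a = c then r else 0 := by
    intro a
    by_cases h : a < c
    · simp [extendCoeff, h, h.ne]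
    · simp [extendCoeff, h]
  simp only [h1, Finset.sum_add_distrib, Finset.sum_ite_eq', Finset.mem_univ, if_true]
  congr 1
  rw [Finset.sum_dite, Finset.sum_const_zero, add_zero]
  refine Finset.sum_bij (fun a _ => ⟨a.1, (Finset.mem_filter.1 a.2).2⟩) (fun _ _ => Finset.mem_univ _)
    (fun a _ b _ h => Subtype.ext
      (congrArg (fun s : {c' : CellIndex d n // c' < c} => s.1) h)) (fun b _ => ?_) fun _ _ => rfl
  exact ⟨⟨b.1, Finset.mem_filter.2 ⟨Finset.mem_univ _, b.2⟩⟩, Finset.mem_univ _, rfl⟩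

theorem continuous_extendCoeff (c : CellIndex d n) :
    Continuous fun p : ({c' : CellIndex d n // c' < c} → ℝ) × ℝ => c.extendCoeff p.1 p.2 := by
  refine continuous_pi fun a => ?_
  by_cases h : a < c
  · simp only [extendCoeff_of_lt h]; fun_prop
  · by_cases h' : a = c
    · subst h'; simp only [extendCoeff_self]; fun_prop
    · simp only [extendCoeff, h, h', dif_neg, not_false_eq_true, if_false]; fun_prop

/-- A characteristic map of the cell of `c`. -/
theorem exists_charMap (hn : 2 ≤ n) (c : CellIndex d n) {m : ℕ} (hm : c.dim = m) :
    ∃ f : (Fin m → ℝ) → Config d n, ContinuousOn f (Metric.closedBall 0 1) ∧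
      InjOn f (Metric.closedBall 0 1) ∧ f '' Metric.closedBall 0 1 = c.cellSet ∧
      f '' Metric.ball 0 1 = comb '' {l | IsBary l ∧ (∀ a, l a ≠ 0 → a ≤ c) ∧ l c ≠ 0} ∧
      f '' Metric.sphere 0 1 ⊆ comb '' {l | IsBary l ∧ ∀ a, l a ≠ 0 → a < c} := by
  obtain ⟨μ, hcont, hinj, hnn, hchain, hsum, hsurj⟩ := c.exists_radial_coords hm
  -- The proper faces receive total weight `‖y‖` and `c` the rest, so the centre of the ball goes to
  -- `c.vertex` and the sphere to combinations of proper faces.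
  let g : (Fin m → ℝ) → CellIndex d n → ℝ := fun y => c.extendCoeff (μ y) (1 - ‖y‖)
  have hbary : ∀ y, ‖y‖ ≤ 1 → IsBary (g y) := by
    intro y hy
    refine ⟨⟨fun a => ?_, fun a b => ?_⟩, ?_⟩
    · by_cases h : a < c
      · simp only [g, extendCoeff_of_lt h]; exact hnn y _
      · by_cases h' : a = c
        · subst h'
          simp only [g, extendCoeff_self]; linarith
        · simp [g, extendCoeff, h, h']
    · by_cases ha : g y a = 0
      · exact Or.inl ha
      by_cases hb : g y b = 0
      · exact Or.inr (Or.inl hb)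
      have ha' := le_of_extendCoeff_ne_zero ha
      have hb' := le_of_extendCoeff_ne_zero hb
      rcases ha'.lt_or_eq with h | rfl
      · rcases hb'.lt_or_eq with h' | rfl
        · have := hchain y ⟨a, h⟩ ⟨b, h'⟩
          simp only [g, extendCoeff_of_lt h, extendCoeff_of_lt h']
          exact this
        · exact Or.inr (Or.inr (Or.inl ha'))
      · exact Or.inr (Or.inr (Or.inr hb'))
    · simp only [g, sum_extendCoeff, hsum]; ring
  have hle : ∀ y a, g y a ≠ 0 → a ≤ c := fun y a h => le_of_extendCoeff_ne_zero h
  have hgc : ∀ y, g y c = 1 - ‖y‖ := fun y => extendCoeff_self c _ _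
  have hex : ∀ l, IsBary l → (∀ a, l a ≠ 0 → a ≤ c) → ∃ y, ‖y‖ = 1 - l c ∧ g y = l := by
    intro l hl hlc
    obtain ⟨y, hy⟩ := hsurj (fun s => l s.1) (fun s => hl.nonneg s.1)
      fun s s' => hl.chain s.1 s'.1
    have hext : l = c.extendCoeff (fun s => l s.1) (l c) := by
      ext a
      by_cases h : a < c
      · rw [extendCoeff_of_lt h]
      · by_cases h' : a = c
        · subst h'; rw [extendCoeff_self]
        · have : l a = 0 := by
            by_contra h0
            exact h ((hlc a h0).lt_of_ne h')
          simp [extendCoeff, h, h', this]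
    have h1 := sum_extendCoeff c (fun s => l s.1) (l c)
    rw [← hext, hl.sum_eq, ← hy, hsum] at h1
    refine ⟨y, by linarith, ?_⟩
    rw [hext]
    simp only [g, hy]
    rw [show 1 - ‖y‖ = l c by linarith]
  refine ⟨fun y => comb (g y), ?_, ?_, ?_, ?_, ?_⟩
  · exact (continuous_comb.comp (c.continuous_extendCoeff.comp
      (hcont.prodMk (continuous_const.sub continuous_norm)))).continuousOn
  · intro y hy y' hy' h
    rw [mem_closedBall_zero_iff] at hy hy'
    have := comb_injOn hn (hbary y hy).toIsChainCoeff (hbary y' hy').toIsChainCoeff h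
    refine hinj (funext fun s => ?_)
    have := congrFun this s.1
    simpa only [g, extendCoeff_of_lt s.2] using this
  · apply Subset.antisymm
    · rintro _ ⟨y, hy, rfl⟩
      rw [mem_closedBall_zero_iff] at hy
      exact ⟨g y, ⟨hbary y hy, hle y⟩, rfl⟩
    · rintro _ ⟨l, ⟨hl, hlc⟩, rfl⟩
      obtain ⟨y, hy, rfl⟩ := hex l hl hlc
      refine ⟨y, ?_, rfl⟩
      rw [mem_closedBall_zero_iff]
      have := hl.nonneg c
      linarith
  · apply Subset.antisymm
    · rintro _ ⟨y, hy, rfl⟩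
      rw [mem_ball_zero_iff] at hy
      refine ⟨g y, ⟨hbary y hy.le, hle y, ?_⟩, rfl⟩
      rw [hgc]; linarith
    · rintro _ ⟨l, ⟨hl, hlc, hc⟩, rfl⟩
      obtain ⟨y, hy, rfl⟩ := hex l hl hlc
      refine ⟨y, ?_, rfl⟩
      rw [mem_ball_zero_iff]
      have := lt_of_le_of_ne (hl.nonneg c) hc.symm
      linarith
  · rintro _ ⟨y, hy, rfl⟩
    rw [mem_sphere_zero_iff_norm] at hy
    refine ⟨g y, ⟨hbary y hy.le, fun a ha => (hle y a ha).lt_of_ne ?_⟩, rfl⟩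
    rintro rfl
    rw [hgc, hy, sub_self] at ha
    exact ha rfl

/-- A chosen characteristic map of the cell of `c`. -/
def charMap (hn : 2 ≤ n) (c : CellIndex d n) {m : ℕ} (hm : c.dim = m) :
    (Fin m → ℝ) → Config d n := (c.exists_charMap hn hm).choose

theorem charMap_spec (hn : 2 ≤ n) (c : CellIndex d n) {m : ℕ} (hm : c.dim = m) :
    ContinuousOn (c.charMap hn hm) (Metric.closedBall 0 1) ∧
      InjOn (c.charMap hn hm) (Metric.closedBall 0 1) ∧
      c.charMap hn hm '' Metric.closedBall 0 1 = c.cellSet ∧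
      c.charMap hn hm '' Metric.ball 0 1 =
        comb '' {l | IsBary l ∧ (∀ a, l a ≠ 0 → a ≤ c) ∧ l c ≠ 0} ∧
      c.charMap hn hm '' Metric.sphere 0 1 ⊆ comb '' {l | IsBary l ∧ ∀ a, l a ≠ 0 → a < c} :=
  (c.exists_charMap hn hm).choose_spec

/-- The characteristic map of a cell as a partial equivalence. -/
def charEquiv (hn : 2 ≤ n) (c : CellIndex d n) {m : ℕ} (hm : c.dim = m) :
    PartialEquiv (Fin m → ℝ) (Config d n) :=
  InjOn.toPartialEquiv (c.charMap hn hm) (Metric.ball 0 1)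
    ((c.charMap_spec hn hm).2.1.mono Metric.ball_subset_closedBall)

/-- The regular cell decomposition of the order complex. -/
abbrev cwComplex (hn : 2 ≤ n) : CWComplex (orderComplex d n hn).space :=
  CWComplex.mkFinite _ (fun m => {c : CellIndex d n // c.dim = m})
    (fun _ c => c.1.charEquiv hn c.2)
    (by
      filter_upwards [eventually_gt_atTop ((d - 1) * (n - 1))] with m hm
      exact ⟨fun c => by have := c.1.dim_le; have := c.2; omega⟩)
    (fun _ => inferInstance)
    (fun _ _ => rfl)
    (fun _ c => (c.1.charMap_spec hn c.2).1)
    (fun _ c => (isCompact_closedBall 0 1).continuousOn_invFunOn Metric.ball_subset_closedBall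
      (c.1.charMap_spec hn c.2).1 (c.1.charMap_spec hn c.2).2.1)
    (by
      rintro ⟨m, c, hc⟩ - ⟨m', c', hc'⟩ - hne
      refine Set.disjoint_left.2 fun x hx hx' => hne ?_
      have h1 : x ∈ c.charMap hn hc '' Metric.ball 0 1 := hx
      have h2 : x ∈ c'.charMap hn hc' '' Metric.ball 0 1 := hx'
      rw [(c.charMap_spec hn hc).2.2.2.1] at h1
      rw [(c'.charMap_spec hn hc').2.2.2.1] at h2
      -- The greatest string in the support of the barycentric coordinates names the open cell, so a
      -- common point forces equal strings.
      obtain ⟨l, ⟨hl, hle, hlc⟩, rfl⟩ := h1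
      obtain ⟨l', ⟨hl', hle', hlc'⟩, h⟩ := h2
      obtain rfl := comb_injOn hn hl'.toIsChainCoeff hl.toIsChainCoeff h
      obtain rfl := le_antisymm (hle' c hlc) (hle c' hlc')
      subst hc
      subst hc'
      rfl)
    (by
      rintro m ⟨c, hc⟩ y hy
      -- A boundary point lies in the closed cell of the greatest string of its support, which is a
      -- proper face and so has smaller dimension.
      obtain ⟨l, ⟨hl, hlt⟩, hx⟩ := (c.charMap_spec hn hc).2.2.2.2 ⟨y, hy, rfl⟩
      obtain ⟨c', hc', hle⟩ := hl.exists_greatest hl.ne_zero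
      have hdim := dim_lt_of_lt (hlt c' hc')
      rw [hc] at hdim
      refine mem_iUnion₂.2 ⟨c'.dim, hdim, mem_iUnion.2 ⟨⟨c', rfl⟩, ?_⟩⟩
      change c.charMap hn hc y ∈ c'.charMap hn rfl '' Metric.closedBall 0 1
      rw [(c'.charMap_spec hn rfl).2.2.1, ← hx]
      exact ⟨l, ⟨hl, hle⟩, rfl⟩)
    (by
      rw [← iUnion_cellSet hn]
      ext x
      simp only [mem_iUnion]
      constructor
      · rintro ⟨m, c, hx⟩
        refine ⟨c.1, ?_⟩
        rw [← (c.1.charMap_spec hn c.2).2.2.1]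
        exact hx
      · rintro ⟨c, hx⟩
        refine ⟨c.dim, ⟨c, rfl⟩, ?_⟩
        rw [← (c.charMap_spec hn rfl).2.2.1] at hx
        exact hx)

end CellIndex

end

/-! ### Assembly of the theorem -/

theorem theorem3 (d n : ℕ) (hd : 1 ≤ d) (hn : 2 ≤ n) :
    -- the projection used for the vertices is the orthogonal projection onto `W_n^{⊕d}`
    (∀ x : Config d n, recenter x = (sumZero d n).starProjection x) ∧
    -- the vertices are pairwise distinct, and `S_n` acts on poset and vertices compatibly
    Function.Injective (CellIndex.vertex : CellIndex d n → Config d n) ∧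
    (∀ (π : Equiv.Perm (Fin n)) (c c' : CellIndex d n), π • c ≤ π • c' ↔ c ≤ c') ∧
    (∀ (π : Equiv.Perm (Fin n)) (c : CellIndex d n), (π • c).vertex = π • c.vertex) ∧
    -- the geometric realization of the order complex
    ∃ K : Geometry.SimplicialComplex ℝ (Config d n),
      K.faces = {s : Finset (Config d n) | ∃ T : Set (CellIndex d n), T.Nonempty ∧ IsChain (· ≤ ·) T ∧
        (s : Set (Config d n)) = CellIndex.vertex '' T} ∧
      K.space ⊆ (sumZero d n : Set (Config d n)) ∧
      IsCompact K.space ∧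
      IsEquivariantStrongDeformationRetract (Equiv.Perm (Fin n)) K.space (confSpace d n) ∧
      -- the regular cell complex whose barycentric subdivision it is
      ∃ _ : Topology.CWComplex K.space,
        Topology.RelCWComplex.Finite K.space ∧
        IsRegularCW K.space ∧
        (∀ m, Nonempty (Topology.CWComplex.cell K.space m) → m ≤ (d - 1) * (n - 1)) ∧
        Nat.card (Topology.CWComplex.cell K.space 0) = n.factorial ∧
        Nat.card (Topology.CWComplex.cell K.space ((d - 1) * (n - 1))) = n.factorial ∧
        (2 ≤ d → Nat.card (Topology.CWComplex.cell K.space ((d - 1) * (n - 1) - 1)) =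
          (n - 1) * n.factorial) ∧
        ∃ e : CellIndex d n ≃ (Σ m, Topology.CWComplex.cell K.space m),
          (∀ c, ((e c).1 : ℤ) = (∑ j, (c.index j : ℤ)) - ((n : ℤ) - 1)) ∧
          (∀ c, IsMax c ↔ (e c).1 = (d - 1) * (n - 1)) ∧
          (∀ c c', Topology.CWComplex.closedCell (C := K.space) (e c).1 (e c).2 ⊆
            Topology.CWComplex.closedCell (C := K.space) (e c').1 (e c').2 ↔ c ≤ c') ∧
          (∀ c, c.vertex ∈ Topology.CWComplex.openCell (C := K.space) (e c).1 (e c).2) ∧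
          (∀ c, Topology.CWComplex.closedCell (C := K.space) (e c).1 (e c).2 =
            ⋃ T ∈ {T : Set (CellIndex d n) | IsChain (· ≤ ·) T ∧ ∀ a ∈ T, a ≤ c},
              convexHull ℝ (CellIndex.vertex '' T)) ∧
          (∀ (π : Equiv.Perm (Fin n)) (c : CellIndex d n),
            (fun x => π • x) '' Topology.CWComplex.closedCell (C := K.space) (e c).1 (e c).2 =
              Topology.CWComplex.closedCell (C := K.space) (e (π • c)).1 (e (π • c)).2) := by
  refine ⟨CellIndex.recenter_eq_starProjection hn, CellIndex.vertex_injective, CellIndex.smul_le_smul_iff,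
    CellIndex.vertex_smul, CellIndex.orderComplex d n hn, rfl, CellIndex.space_subset_sumZero hn,
    CellIndex.isCompact_space_orderComplex hn, CellIndex.isEquivariantStrongDeformationRetract hn,
    CellIndex.cwComplex hn, ?_⟩
  let _ := CellIndex.cwComplex (d := d) hn
  -- The cells of dimension `m` are the strings with `dim` equal to `m`, so all cells together are
  -- the fibres of `dim`.
  let e : CellIndex d n ≃
      (Σ m, Topology.CWComplex.cell (CellIndex.orderComplex d n hn).space m) :=
    (Equiv.sigmaFiberEquiv (CellIndex.dim (d := d) (n := n))).symm
  have hclosed : ∀ c, Topology.CWComplex.closedCell (C := (CellIndex.orderComplex d n hn).space)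
      (e c).1 (e c).2 = c.cellSet := fun c => (c.charMap_spec hn rfl).2.2.1
  have hopen : ∀ c, Topology.CWComplex.openCell (C := (CellIndex.orderComplex d n hn).space)
      (e c).1 (e c).2 = CellIndex.comb ''
        {l | CellIndex.IsBary l ∧ (∀ a, l a ≠ 0 → a ≤ c) ∧ l c ≠ 0} :=
    fun c => (c.charMap_spec hn rfl).2.2.2.1
  refine ⟨Topology.CWComplex.finite_mkFinite _ _ _ _ _ _ _ _ _ _ _,
    fun m c => (c.1.charMap_spec hn c.2).2.1, ?_, ?_, ?_, fun hd2 => ?_, e, ?_, ?_, ?_, ?_, ?_, ?_⟩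
  · rintro m ⟨c⟩
    exact c.2 ▸ c.1.dim_le
  · rw [← CellIndex.card_const (d := d) ⟨0, by omega⟩]
    exact Nat.card_congr (Equiv.subtypeEquivRight fun c => c.dim_eq_zero_iff hd)
  · rw [← CellIndex.card_const (d := d) ⟨d - 1, by omega⟩]
    exact Nat.card_congr (Equiv.subtypeEquivRight fun c => c.dim_eq_iff hd)
  · exact CellIndex.card_dim_eq_sub_one hd2 hn
  · intro c
    -- `index` counts from 1 and `dim` sums entries counted from 0; the `n - 1` positions account
    -- for the difference.
    have h : ∑ j, (c.index j : ℤ) = (c.dim : ℤ) + ((n : ℤ) - 1) := by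
      have : ((n - 1 : ℕ) : ℤ) = (n : ℤ) - 1 := by omega
      simp [CellIndex.index, CellIndex.dim, Finset.sum_add_distrib, this]
    rw [h, add_sub_cancel_right]
    rfl
  · exact CellIndex.isMax_iff hd
  · intro c c'
    rw [hclosed, hclosed, CellIndex.cellSet_subset_iff hn]
  · intro c
    classical
    rw [hopen]
    refine ⟨Pi.single c 1, ⟨CellIndex.isBary_single c, fun a ha => ?_, by simp⟩,
      CellIndex.comb_single c⟩
    by_cases h : a = c
    · rw [h]
    · simp [h] at ha
  · intro c
    rw [hclosed, CellIndex.cellSet_eq_iUnion]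
  · intro π c
    rw [hclosed, hclosed, CellIndex.smul_image_cellSet]
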